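/- For $x>0$ and $(r,s,t)\in\mathbb{C}^3$ with $\Re(r+t)>1$, $\Re(s+t)>1$ and $\Re(r+s+t)>2$, let $$\Theta(r,s,t,x)=\sum_{n=1}^{\infty}\sum_{m=1}^{\infty}\frac{1}{n^{r}m^{s}(n+mx)^{t}},$$ an absolutely convergent double series. Fix $x>0$, an integer $r\ge 1$, an integer $\ell\ge 0$ and $s\in\mathbb{C}$. The function $t\mapsto\Theta(r,s,t,x)$ has a meromorphic continuation to all of $\mathbb{C}$, denoted in the same way. Put $t_0=1-r-\ell$ and $N=r+\ell-1$. Let $\zeta$ be the Riemann zeta function, $\gamma$ Euler's constant, $H_n=\sum_{j=1}^{n}1/j$ (so $H_0=0$) and $\psi=\Gamma'/\Gamma$. Then, as $t\to t_0$, $t\neq t_0$, the following hold. 1. If $s\in\mathbb{Z}$ and $s>r+\ell$, or if $s\in\mathbb{C}\setminus\mathbb{Z}$, then $$\Theta(r,s,t,x)=\binom{N}{\ell}x^{\ell}\frac{\zeta(s-\ell)}{t-t_0}+\binom{N}{\ell}x^{\ell}\zeta(s-\ell)\left(\gamma+H_{r-1}-H_{N}\right)+\sum_{\substack{0\le k\le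 N\\ k\ne r-1}}\binom{N}{k}x^{N-k}\zeta(r-k)\zeta(k-N+s)+O(|t-t_0|).$$ 2. If $s\in\mathbb{Z}$ and $s\le 0$ (so that $s\le r+\ell$), then $$\begin{aligned}\Theta(r,s,t,x)={}&\binom{N}{\ell}x^{\ell}\frac{\zeta(s-\ell)}{t-t_0}+\binom{N}{\ell}x^{\ell}\zeta(s-\ell)\left(\gamma+H_{r-1}-H_{N}\right)+\sum_{\substack{0\le k\le N\\ k\ne r-1}}\binom{N}{k}x^{N-k}\zeta(r-k)\zeta(k-N+s)\\&+(-1)^{s-1}\frac{N!\,(-s)!}{(r+\ell-s)!}x^{s-1}\zeta(s-\ell)+O(|t-t_0|).\end{aligned}$$ 3. If $s\in\mathbb{Z}$, $1\le s\le r+\ell$ and $s\ne\ell+1$, then $$\begin{aligned}\Theta(r,s,t,x)={}&\binom{N}{\ell}x^{\ell}\frac{\zeta(s-\ell)}{t-t_0}+\binom{N}{\ell}x^{\ell}\zeta(s-\ell)\left(\gamma+H_{r-1}-H_{N}\right)\\&+\binom{N}{s-1}x^{s-1}\frac{\zeta(s-\ell)}{t-t_0}+\binom{N}{s-1}x^{s-1}\zeta(s-\ell)\left(\gamma+H_{s-1}-H_{N}-\log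 x\right)\\&+\sum_{\substack{0\le k\le N\\ k\ne r-1,\ k\ne r+\ell-s}}\binom{N}{k}x^{N-k}\zeta(r-k)\zeta(k-N+s)+O(|t-t_0|).\end{aligned}$$ 4. If $s=\ell+1$, then $$\begin{aligned}\Theta(r,s,t,x)={}&\binom{N}{\ell}\frac{2x^{\ell}}{(t-t_0)^2}+\binom{N}{\ell}\frac{x^{\ell}\left(2\gamma+H_{\ell}+H_{r-1}-2H_{N}-\log x\right)}{t-t_0}\\&+\frac13\binom{N}{\ell}x^{\ell}\Big(-\pi^2+3\left(\gamma+H_{\ell}-H_{N}-\log x\right)\left(\gamma+H_{r-1}-H_{N}\right)+3\psi'(r+\ell)\Big)\\&+\sum_{\substack{0\le k\le N\\ k\ne r-1}}\binom{N}{k}x^{N-k}\zeta(r-k)\zeta(k-r+2)+O(|t-t_0|).\end{aligned}$$ -/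

import Mathlib

open Filter Topology Asymptotics

/-- The general term `1 / (n ^ r * m ^ s * (n + m * x) ^ t)` of the generalized Mordell-Tornheim
series, the positive integers being written `n = p.1 + 1` and `m = p.2 + 1`. All the bases are
positive reals, so the principal complex power is the usual one. -/
noncomputable def thetaTerm (r s t : ℂ) (x : ℝ) (p : ℕ × ℕ) : ℂ :=
  1 / (((p.1 : ℂ) + 1) ^ r * ((p.2 : ℂ) + 1) ^ s *
    (((p.1 : ℂ) + 1) + ((p.2 : ℂ) + 1) * (x : ℂ)) ^ t)

/-- The region of (absolute) convergence of the double series. -/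
def thetaRegion (r s t : ℂ) : Prop :=
  1 < (r + t).re ∧ 1 < (s + t).re ∧ 2 < (r + s + t).re

/-- `F` is the function `t ↦ Θ(r, s, t, x)`: it is meromorphic on the whole complex plane and it is
the (absolutely convergent) double series wherever `(r, s, t)` lies in the region of convergence,
which contains a half-plane of values of `t`. Two such functions agree off a discrete set. -/
def IsTheta (r s : ℂ) (x : ℝ) (F : ℂ → ℂ) : Prop :=
  Meromorphic F ∧ ∀ t : ℂ, thetaRegion r s t → HasSum (thetaTerm r s t x) (F t)

/-! Far to the right in `t`, `Γ(t) Θ(r, s, t, x)` is the Mellin transform at `t` of `Li_r(e^{-u})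
Li_s(e^{-xu})`. As `u → 0+`, for an integer `r ≥ 1`, `Li_r(e^{-u})` equals `(-u)^(r-1)/(r-1)! *
(H_{r-1} - log u) + ∑_{k ≠ r-1} ζ(r-k) (-u)^k / k!` to any order (`polylogRem_isBigO`); the
logarithm replaces the term in which `ζ(1)` would stand.

Only this factor is expanded. Against `Li_s(e^{-xu})`, the monomial `u^k` has Mellin transform `G(t
+ k)`, where `G(z) = Γ(z) x^{-z} ζ(s + z)`, and `u^k log u` has `G'(t + k)`. The remainder gives a
function analytic in a half-plane that widens with the order (`analyticAt_thetaRem`). Dividing by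
`Γ(t)` yields the continuation, and the identity theorem makes every admissible `F` agree with it
near `t₀` off `t₀` (`IsTheta.eventuallyEq_thetaCont`).

At `t₀ = -N` the factor `1/Γ` vanishes, so up to `O(t - t₀)` only principal parts count. `G` has
poles at `-j` from `Γ` and at `1 - s` from `ζ`. If they stay apart, each `k ≤ N` other than `r-1`
gives a constant, and `k = r-1` gives a pole through `G'` (case 1). For an integer `s ≤ 0` the pole
of `ζ` is met at some `k > N`, which adds one constant (case 2). For `1 ≤ s ≤ N + 1` it coincides
with a pole of `Γ`: at an ordinary index it produces a second polar term (case 3); at `k = r-1`,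
that is `s = ℓ + 1`, differentiating the double pole makes a triple one (case 4). The expansion of
`1/Γ` to third order (`inv_Gamma_isBigO`) then supplies `ψ'` and `π²`. -/

/-! ### The function `Li_s(e^{-v})` for `v > 0`: bounds, derivative, special values. -/

/-- The function `v ↦ Li_s(exp (-v))`. -/
noncomputable def polylogExp (s : ℂ) (v : ℝ) : ℂ :=
  ∑' n : ℕ, ((n : ℂ) + 1) ^ (-s) * (Real.exp (-((n : ℝ) + 1) * v) : ℂ)

theorem norm_natCast_add_one_cpow (n : ℕ) (s : ℂ) :
    ‖((n : ℂ) + 1) ^ s‖ = ((n : ℝ) + 1) ^ s.re := by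
  have h : ((n : ℂ) + 1) = (((n : ℝ) + 1 : ℝ) : ℂ) := by push_cast; rfl
  rw [h, Complex.norm_cpow_eq_rpow_re_of_pos (by positivity)]

theorem exp_neg_le_factorial_div_pow (A : ℕ) {y : ℝ} (hy : 0 < y) :
    Real.exp (-y) ≤ A.factorial / y ^ A := by
  have h := Real.pow_div_factorial_le_exp y hy.le A
  rw [Real.exp_neg, inv_le_comm₀ (Real.exp_pos y) (by positivity)]
  simpa using h

/-- The integer `A` is free: trading the exponential for `(n v)^{-A}` makes the sum over `n`
converge once `Re s + A > 1`, at the price of `v^{-A}`. One bound thus controls both the blow-up at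
`0` and the rapid decay at infinity. -/
theorem norm_polylogExp_term_le (s : ℂ) (A n : ℕ) {v : ℝ} (hv : 0 < v) :
    ‖((n : ℂ) + 1) ^ (-s) * (Real.exp (-((n : ℝ) + 1) * v) : ℂ)‖ ≤
      A.factorial / v ^ A * ((n : ℝ) + 1) ^ (-(s.re + A)) := by
  have hn : (0 : ℝ) < (n : ℝ) + 1 := by positivity
  rw [norm_mul, norm_natCast_add_one_cpow, Complex.norm_real, Real.norm_eq_abs, Real.abs_exp,
    neg_mul]
  have h := exp_neg_le_factorial_div_pow A (mul_pos hn hv)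
  calc ((n : ℝ) + 1) ^ (-s).re * Real.exp (-(((n : ℝ) + 1) * v))
      ≤ ((n : ℝ) + 1) ^ (-s).re * (A.factorial / (((n : ℝ) + 1) * v) ^ A) := by gcongr
    _ = A.factorial / v ^ A * ((n : ℝ) + 1) ^ (-(s.re + A)) := by
      rw [neg_add, Real.rpow_add hn, Real.rpow_neg hn.le (A : ℝ), Real.rpow_natCast, mul_pow,
        Complex.neg_re]
      field_simp

theorem summable_natCast_add_one_rpow {a : ℝ} (ha : 1 < a) :
    Summable fun n : ℕ => ((n : ℝ) + 1) ^ (-a) := by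
  have h := (summable_nat_add_iff 1).2 (Real.summable_nat_rpow.2 (neg_lt_neg ha))
  simpa using h

theorem exists_nat_one_lt_add (a : ℝ) : ∃ A : ℕ, 1 < a + A := by
  obtain ⟨A, hA⟩ := exists_nat_gt (1 - a)
  exact ⟨A, by linarith⟩

theorem summable_polylogExp (s : ℂ) {v : ℝ} (hv : 0 < v) :
    Summable fun n : ℕ => ((n : ℂ) + 1) ^ (-s) * (Real.exp (-((n : ℝ) + 1) * v) : ℂ) := by
  obtain ⟨A, hA⟩ := exists_nat_one_lt_add s.re
  exact Summable.of_norm_bounded ((summable_natCast_add_one_rpow hA).mul_left _)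
    fun n => norm_polylogExp_term_le s A n hv

theorem exists_norm_polylogExp_le (s : ℂ) {A : ℕ} (hA : 1 < s.re + A) :
    ∃ C : ℝ, ∀ v : ℝ, 0 < v → ‖polylogExp s v‖ ≤ C * v ^ (-(A : ℝ)) := by
  refine ⟨A.factorial * ∑' n : ℕ, ((n : ℝ) + 1) ^ (-(s.re + A)), fun v hv => ?_⟩
  have h := tsum_of_norm_bounded ((summable_natCast_add_one_rpow hA).mul_left
    ((A.factorial : ℝ) / v ^ A)).hasSum fun n => norm_polylogExp_term_le s A n hv
  refine h.trans (le_of_eq ?_)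
  rw [tsum_mul_left, Real.rpow_neg hv.le, Real.rpow_natCast]
  ring

/-- Termwise differentiation brings down `-(n + 1)`, which lowers the order by one; on `(v/2, ∞)`
the differentiated series has a uniform majorant. -/
theorem hasDerivAt_polylogExp (s : ℂ) {v : ℝ} (hv : 0 < v) :
    HasDerivAt (polylogExp s) (-polylogExp (s - 1) v) v := by
  obtain ⟨A, hA⟩ := exists_nat_one_lt_add (s - 1).re
  have hsum := (summable_natCast_add_one_rpow hA).mul_left ((A.factorial : ℝ) / (v / 2) ^ A)
  have key : ∀ (n : ℕ) (y : ℝ), ((n : ℂ) + 1) ^ (-s) *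
      ((Real.exp (-((n : ℝ) + 1) * y) * -((n : ℝ) + 1) : ℝ) : ℂ) =
      -(((n : ℂ) + 1) ^ (-(s - 1)) * (Real.exp (-((n : ℝ) + 1) * y) : ℂ)) := by
    intro n y
    rw [show -(s - 1) = -s + 1 by ring, Complex.cpow_add _ _ (Nat.cast_add_one_ne_zero n),
      Complex.cpow_one]
    push_cast
    ring
  have hd := hasDerivAt_tsum_of_isPreconnected (t := Set.Ioi (v / 2)) (y₀ := v) (y := v)
    (g := fun (n : ℕ) (y : ℝ) => ((n : ℂ) + 1) ^ (-s) * (Real.exp (-((n : ℝ) + 1) * y) : ℂ))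
    (g' := fun (n : ℕ) (y : ℝ) =>
      ((n : ℂ) + 1) ^ (-s) * ((Real.exp (-((n : ℝ) + 1) * y) * -((n : ℝ) + 1) : ℝ) : ℂ))
    hsum isOpen_Ioi isPreconnected_Ioi ?_ ?_ (by simpa using hv) (summable_polylogExp s hv)
    (by simpa using hv)
  · convert! hd using 1
    simp_rw [key, tsum_neg]
    rfl
  · intro n y _
    refine HasDerivAt.const_mul _ (HasDerivAt.ofReal_comp ?_)
    simpa using ((hasDerivAt_id y).const_mul (-((n : ℝ) + 1))).exp
  · intro n y hy
    have hy' : v / 2 < y := hy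
    have hy0 : 0 < y := by linarith
    rw [key, norm_neg]
    refine (norm_polylogExp_term_le (s - 1) A n hy0).trans ?_
    gcongr

theorem continuousOn_polylogExp (s : ℂ) : ContinuousOn (polylogExp s) (Set.Ioi 0) :=
  fun _ hv => (hasDerivAt_polylogExp s hv).continuousAt.continuousWithinAt

theorem polylogExp_zero {u : ℝ} (hu : 0 < u) :
    polylogExp 0 u = ((Real.exp u - 1 : ℝ) : ℂ)⁻¹ := by
  have h1 : Real.exp (-u) < 1 := by simpa using hu
  have h := hasSum_geometric_of_lt_one (Real.exp_pos (-u)).le h1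
  have h2 := (h.mul_left (Real.exp (-u)))
  have h3 : polylogExp 0 u = ((Real.exp (-u) * (1 - Real.exp (-u))⁻¹ : ℝ) : ℂ) := by
    refine HasSum.tsum_eq ?_
    convert! Complex.hasSum_ofReal.2 h2 using 2 with n
    rw [neg_zero, Complex.cpow_zero, one_mul, ← pow_succ', ← Real.exp_nat_mul]
    push_cast
    ring_nf
  rw [h3, ← Complex.ofReal_inv]
  congr 1
  have : Real.exp u ≠ 0 := (Real.exp_pos u).ne'
  have h4 : Real.exp u - 1 ≠ 0 := by
    have := Real.one_lt_exp_iff.2 hu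
    linarith
  rw [Real.exp_neg]
  have h5 : 1 - (Real.exp u)⁻¹ = (Real.exp u - 1) / Real.exp u := by field_simp
  rw [h5]
  field_simp

theorem polylogExp_one {u : ℝ} (hu : 0 < u) :
    polylogExp 1 u = ((-Real.log (1 - Real.exp (-u)) : ℝ) : ℂ) := by
  have h1 : |Real.exp (-u)| < 1 := by rw [Real.abs_exp]; simpa using hu
  refine HasSum.tsum_eq ?_
  convert! Complex.hasSum_ofReal.2 (Real.hasSum_pow_div_log_of_abs_lt_one h1) using 2 with n
  rw [Complex.cpow_neg_one, ← Real.exp_nat_mul]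
  push_cast
  rw [inv_mul_eq_div]
  ring_nf

theorem tendsto_polylogExp_zero {s : ℂ} (hs : 1 < s.re) :
    Tendsto (polylogExp s) (𝓝[>] 0) (𝓝 (riemannZeta s)) := by
  have hz : riemannZeta s = ∑' n : ℕ, ((n : ℂ) + 1) ^ (-s) := by
    rw [zeta_eq_tsum_one_div_nat_add_one_cpow hs]
    simp [Complex.cpow_neg]
  rw [hz]
  refine tendsto_tsum_of_dominated_convergence (summable_natCast_add_one_rpow hs) ?_ ?_
  · intro n
    have hc : Continuous fun v : ℝ =>
        ((n : ℂ) + 1) ^ (-s) * (Real.exp (-((n : ℝ) + 1) * v) : ℂ) := by fun_prop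
    have := (hc.tendsto 0).mono_left (nhdsWithin_le_nhds (s := Set.Ioi 0))
    simpa using this
  · filter_upwards [self_mem_nhdsWithin] with v hv n
    simpa using norm_polylogExp_term_le s 0 n hv

/-! ### Expansion of `Li_r(e^{-u})` as `u → 0+` for natural numbers `r`. -/

/-- Integrating an asymptotic bound at `0`. -/
theorem isBigO_pow_succ_of_hasDerivAt {f f' : ℝ → ℂ} {K : ℕ}
    (hd : ∀ u : ℝ, 0 < u → HasDerivAt f (f' u) u)
    (hf' : f' =O[𝓝[>] 0] fun u : ℝ => u ^ K) (h0 : Tendsto f (𝓝[>] 0) (𝓝 0)) :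
    f =O[𝓝[>] 0] fun u : ℝ => u ^ (K + 1) := by
  obtain ⟨C, hC⟩ := hf'.bound
  obtain ⟨δ, hδ, hb⟩ := (mem_nhdsGT_iff_exists_Ioo_subset' (zero_lt_one' ℝ)).1 hC
  refine IsBigO.of_bound C ?_
  filter_upwards [Ioo_mem_nhdsGT (show (0 : ℝ) < δ from hδ)] with u hu
  have hC0 : ∀ y ∈ Set.Ioc 0 u, ‖f' y‖ ≤ C * u ^ K := by
    intro y hy
    have h1 : ‖f' y‖ ≤ C * ‖y ^ K‖ := hb ⟨hy.1, hy.2.trans_lt hu.2⟩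
    have hyK : ‖y ^ K‖ = y ^ K := by rw [Real.norm_eq_abs, abs_of_pos (pow_pos hy.1 _)]
    rw [hyK] at h1
    have hCpos : 0 ≤ C := by
      by_contra hneg
      have h2 := norm_nonneg (f' y)
      have h3 := mul_neg_of_neg_of_pos (not_le.1 hneg) (pow_pos hy.1 K)
      linarith
    exact h1.trans (mul_le_mul_of_nonneg_left (pow_le_pow_left₀ hy.1.le hy.2 K) hCpos)
  -- Nothing is known about `f` at `0` itself, so the mean value inequality is used on `[v, u]` and
  -- then `v → 0+`.
  have hlim : Tendsto (fun v : ℝ => ‖f u - f v‖) (𝓝[>] 0) (𝓝 ‖f u - 0‖) :=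
    (tendsto_const_nhds.sub h0).norm
  have hlim2 : Tendsto (fun v : ℝ => C * u ^ K * ‖u - v‖) (𝓝[>] 0) (𝓝 (C * u ^ K * ‖u - 0‖)) := by
    have hc : Continuous fun v : ℝ => C * u ^ K * ‖u - v‖ := by fun_prop
    exact (hc.tendsto 0).mono_left nhdsWithin_le_nhds
  have := le_of_tendsto_of_tendsto hlim hlim2 ?_
  · rw [sub_zero, sub_zero] at this
    rw [norm_pow, pow_succ, ← mul_assoc]
    rwa [Real.norm_of_nonneg hu.1.le] at this ⊢
  · filter_upwards [Ioo_mem_nhdsGT hu.1] with v hv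
    exact Convex.norm_image_sub_le_of_norm_hasDerivWithin_le
      (fun y hy => (hd y hy.1).hasDerivWithinAt) hC0 (convex_Ioc 0 u) ⟨hv.1, hv.2.le⟩
      ⟨hu.1, le_rfl⟩

-- Truncated form of `B(X) (e^X - 1) = X`, the generating identity of the Bernoulli numbers. It
-- settles the base case `Li_0(e^{-u}) = 1/(e^u - 1)`.
open Polynomial in
theorem exists_bernoulli_trunc_mul_exp_trunc (K : ℕ) : ∃ R : ℝ[X],
    PowerSeries.trunc (K + 1) (bernoulliPowerSeries ℝ) *
      PowerSeries.trunc (K + 2) (PowerSeries.exp ℝ - 1) = X + X ^ (K + 2) * R := by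
  have h : (X : ℝ[X]) ^ (K + 2) ∣ PowerSeries.trunc (K + 1) (bernoulliPowerSeries ℝ) *
      PowerSeries.trunc (K + 2) (PowerSeries.exp ℝ - 1) - X := by
    rw [X_pow_dvd_iff]
    intro d hd
    have hX := congrArg (PowerSeries.coeff d) (bernoulliPowerSeries_mul_exp_sub_one ℝ)
    rw [PowerSeries.coeff_mul] at hX
    have hX' : (PowerSeries.coeff d) (PowerSeries.X : PowerSeries ℝ) = (X : ℝ[X]).coeff d := by
      rw [PowerSeries.coeff_X, coeff_X]
      simp [eq_comm]
    rw [coeff_sub, ← hX', ← hX, coeff_mul, sub_eq_zero]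
    refine Finset.sum_congr rfl fun p hp => ?_
    have hp' := Finset.HasAntidiagonal.mem_antidiagonal.1 hp
    rw [PowerSeries.coeff_trunc, PowerSeries.coeff_trunc]
    -- Since `e^X - 1` has no constant term, the Bernoulli coefficient of degree `K + 1` is never
    -- needed in degrees up to `K + 1`; hence the two different truncation lengths.
    rcases Nat.eq_zero_or_pos p.2 with h2 | h2
    · simp [h2]
    · rw [if_pos (by omega), if_pos (by omega)]
  obtain ⟨R, hR⟩ := h
  exact ⟨R, by rw [← hR]; ring⟩

/-- The logarithmic (for `r = 0`, polar) part of `polylogExp r` at the origin. -/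
noncomputable def polylogSing : ℕ → ℝ → ℂ
  | 0, u => (u : ℂ)⁻¹
  | r + 1, u => (-(u : ℂ)) ^ r / r.factorial * ((harmonic r : ℂ) - (Real.log u : ℂ))

/-- The Taylor coefficients of the regular part of `polylogExp r` at the origin. -/
noncomputable def polylogCoeff (r k : ℕ) : ℂ :=
  if k + 1 = r then 0 else riemannZeta (r - k) * (-1) ^ k / k.factorial

/-- The remainder of order `K` in the expansion of `polylogExp r` at the origin. -/
noncomputable def polylogRem (r K : ℕ) (u : ℝ) : ℂ :=
  polylogExp r u - polylogSing r u - ∑ k ∈ Finset.range K, polylogCoeff r k * (u : ℂ) ^ k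

theorem polylogCoeff_succ (r k : ℕ) :
    polylogCoeff (r + 1) (k + 1) * (k + 1) = -polylogCoeff r k := by
  unfold polylogCoeff
  by_cases h : k + 1 = r
  · simp [h]
  · rw [if_neg (by omega), if_neg h, Nat.factorial_succ]
    have h1 : ((k : ℂ) + 1) ≠ 0 := Nat.cast_add_one_ne_zero k
    have h2 : ((k.factorial : ℕ) : ℂ) ≠ 0 := by exact_mod_cast k.factorial_ne_zero
    have h3 : (((r + 1 : ℕ) : ℂ) - ((k + 1 : ℕ) : ℂ)) = r - k := by push_cast; ring
    rw [h3]
    push_cast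
    field_simp
    ring

theorem hasDerivAt_polylogSing (r : ℕ) {u : ℝ} (hu : 0 < u) :
    HasDerivAt (polylogSing (r + 1)) (-polylogSing r u) u := by
  have hu' : (u : ℂ) ≠ 0 := by exact_mod_cast hu.ne'
  have hid : HasDerivAt (fun y : ℝ => (y : ℂ)) 1 u := by
    simpa using (hasDerivAt_id u).ofReal_comp
  have hlog : HasDerivAt (fun y : ℝ => (Real.log y : ℂ)) ((u : ℂ)⁻¹) u := by
    simpa using (Real.hasDerivAt_log hu.ne').ofReal_comp
  have h := ((hid.neg.pow r).div_const (r.factorial : ℂ)).mul (hlog.const_sub (harmonic r : ℂ))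
  convert! h using 1
  rcases r with _ | r
  · simp [polylogSing]
  · have h1 : ((r : ℂ) + 1) ≠ 0 := Nat.cast_add_one_ne_zero r
    have h2 : ((r.factorial : ℕ) : ℂ) ≠ 0 := by exact_mod_cast r.factorial_ne_zero
    simp only [polylogSing, Nat.factorial_succ, harmonic_succ, add_tsub_cancel_right]
    push_cast
    simp only [Pi.neg_apply, Pi.pow_apply]
    field_simp
    ring

theorem hasDerivAt_polylogRem (r K : ℕ) {u : ℝ} (hu : 0 < u) :
    HasDerivAt (polylogRem (r + 1) (K + 1)) (-polylogRem r K u) u := by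
  have hid : HasDerivAt (fun y : ℝ => (y : ℂ)) 1 u := by
    simpa using (hasDerivAt_id u).ofReal_comp
  have h1 := hasDerivAt_polylogExp ((r + 1 : ℕ) : ℂ) hu
  have h3 : HasDerivAt (fun y : ℝ => ∑ k ∈ Finset.range (K + 1), polylogCoeff (r + 1) k * (y : ℂ) ^ k)
      (∑ k ∈ Finset.range (K + 1), polylogCoeff (r + 1) k * (k * (u : ℂ) ^ (k - 1) * 1)) u :=
    HasDerivAt.fun_sum fun k _ => (hid.pow k).const_mul _
  convert! (h1.sub (hasDerivAt_polylogSing r hu)).sub h3 using 1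
  rw [Finset.sum_range_succ']
  have : ∀ k, polylogCoeff (r + 1) (k + 1) * (((k + 1 : ℕ) : ℂ) * (u : ℂ) ^ (k + 1 - 1) * 1) =
      -(polylogCoeff r k * (u : ℂ) ^ k) := by
    intro k
    rw [← neg_mul, ← polylogCoeff_succ, Nat.add_sub_cancel]
    push_cast
    ring
  simp_rw [this, Finset.sum_neg_distrib, polylogRem]
  push_cast
  simp
  ring

/-- Fixes the constant of integration for the induction on the order. For order one it is the limit
of `-log((1 - e^{-u})/u)`; for higher orders it is `ζ(r + 1)`, the singular part vanishing because
`u log u → 0`. -/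
theorem tendsto_polylogRem (r K : ℕ) :
    Tendsto (polylogRem (r + 1) (K + 1)) (𝓝[>] 0) (𝓝 0) := by
  have hpoly : Tendsto (fun u : ℝ => ∑ k ∈ Finset.range (K + 1), polylogCoeff (r + 1) k * (u : ℂ) ^ k)
      (𝓝[>] 0) (𝓝 (polylogCoeff (r + 1) 0)) := by
    have hc : Continuous fun u : ℝ =>
      ∑ k ∈ Finset.range (K + 1), polylogCoeff (r + 1) k * (u : ℂ) ^ k := by fun_prop
    convert! (hc.tendsto 0).mono_left nhdsWithin_le_nhds using 2
    rw [Finset.sum_range_succ']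
    simp
  suffices h : Tendsto (fun u => polylogExp (r + 1 : ℕ) u - polylogSing (r + 1) u) (𝓝[>] 0)
      (𝓝 (polylogCoeff (r + 1) 0)) by
    have := h.sub hpoly
    rwa [sub_self] at this
  rcases r with _ | r
  · have hslope : Tendsto (fun u : ℝ => (1 - Real.exp (-u)) / u) (𝓝[>] 0) (𝓝 1) := by
      have hd : HasDerivAt (fun u : ℝ => 1 - Real.exp (-u)) 1 0 := by
        simpa using ((hasDerivAt_neg (0 : ℝ)).exp).const_sub 1
      have h := (hasDerivAt_iff_tendsto_slope.1 hd).mono_left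
        (nhdsWithin_mono 0 (fun y (hy : 0 < y) => hy.ne'))
      refine h.congr fun u => ?_
      simp [slope_def_field]
    have hl := (Complex.continuous_ofReal.tendsto _).comp
      ((Real.continuousAt_log one_ne_zero).tendsto.comp hslope).neg
    have hc0 : polylogCoeff (0 + 1) 0 = 0 := by simp [polylogCoeff]
    rw [hc0]
    simp only [Real.log_one, neg_zero, Complex.ofReal_zero] at hl
    refine hl.congr' ?_
    filter_upwards [self_mem_nhdsWithin] with u hu
    have hu' : (0 : ℝ) < u := hu
    have h1 : 1 - Real.exp (-u) ≠ 0 := by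
      have : Real.exp (-u) < 1 := by simpa using hu'
      linarith
    simp only [Function.comp, polylogSing, zero_add, Nat.cast_one]
    rw [polylogExp_one hu', Real.log_div h1 hu'.ne']
    simp
    ring
  · have hs : 1 < (((r + 1 + 1 : ℕ) : ℂ)).re := by
      rw [Complex.natCast_re]
      push_cast
      linarith [(Nat.cast_nonneg r : (0 : ℝ) ≤ r)]
    have hc0 : polylogCoeff (r + 1 + 1) 0 = riemannZeta ((r + 1 + 1 : ℕ) : ℂ) - 0 := by
      simp [polylogCoeff]
    rw [hc0]
    refine (tendsto_polylogExp_zero hs).sub ?_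
    have hlog : Tendsto (fun u : ℝ => u * Real.log u) (𝓝[>] 0) (𝓝 0) := by
      have := (Real.continuous_mul_log.tendsto 0).mono_left
        (nhdsWithin_le_nhds (s := Set.Ioi (0 : ℝ)))
      simpa using this
    have hid : Tendsto (fun u : ℝ => u) (𝓝[>] 0) (𝓝 0) := nhdsWithin_le_nhds
    have h1 : Tendsto (fun u : ℝ => (((u * (harmonic (r + 1) : ℝ) - u * Real.log u) : ℝ) : ℂ))
        (𝓝[>] 0) (𝓝 0) := by
      have := (Complex.continuous_ofReal.tendsto _).comp ((hid.mul_const (harmonic (r + 1) : ℝ)).sub hlog)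
      simp only [zero_mul, sub_zero, Complex.ofReal_zero] at this
      exact this
    have h2 : Tendsto (fun u : ℝ => -(-(u : ℂ)) ^ r / (r + 1).factorial) (𝓝[>] 0)
        (𝓝 (-(-((0 : ℝ) : ℂ)) ^ r / (r + 1).factorial)) := by
      have hc : Continuous fun u : ℝ => -(-(u : ℂ)) ^ r / (r + 1).factorial := by fun_prop
      exact (hc.tendsto 0).mono_left nhdsWithin_le_nhds
    have h3 := h2.mul h1
    rw [mul_zero] at h3
    refine h3.congr fun u => ?_
    simp only [polylogSing]
    push_cast
    ring

/-- The coefficients match because `ζ(-k) = (-1)^k B_{k+1}/(k+1)`. -/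
theorem polylogRem_zero_isBigO (K : ℕ) :
    polylogRem 0 K =O[𝓝[>] 0] fun u : ℝ => u ^ K := by
  obtain ⟨R, hR⟩ := exists_bernoulli_trunc_mul_exp_trunc K
  set P := PowerSeries.trunc (K + 1) (bernoulliPowerSeries ℝ) with hP
  set Q := PowerSeries.trunc (K + 2) (PowerSeries.exp ℝ - 1) with hQ
  have heval : ∀ (n : ℕ) (f : PowerSeries ℝ) (u : ℝ), (PowerSeries.trunc n f).eval u =
      ∑ i ∈ Finset.range n, PowerSeries.coeff i f * u ^ i := fun n f u =>
    PowerSeries.eval₂_trunc_eq_sum_range u (RingHom.id ℝ) n f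
  have hQe : ∀ u : ℝ, Q.eval u = ∑ i ∈ Finset.range (K + 2), u ^ i / i.factorial - 1 := by
    intro u
    rw [hQ, PowerSeries.trunc_sub, Polynomial.eval_sub, PowerSeries.trunc_one,
      heval]
    simp [PowerSeries.coeff_exp, div_eq_inv_mul]
  have hPe : ∀ u : ℝ, P.eval u = 1 + u * ∑ k ∈ Finset.range K,
      ((bernoulli (k + 1) : ℝ) / (k + 1).factorial) * u ^ k := by
    intro u
    rw [hP, heval, Finset.sum_range_succ', Finset.mul_sum, add_comm]
    simp [bernoulliPowerSeries, pow_succ]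
    refine Finset.sum_congr rfl fun k _ => ?_
    ring
  have hcoef : ∀ k, polylogCoeff 0 k = (((bernoulli (k + 1) : ℝ) / (k + 1).factorial : ℝ) : ℂ) := by
    intro k
    have h1 : ((k : ℂ) + 1) ≠ 0 := Nat.cast_add_one_ne_zero k
    have h2 : ((k.factorial : ℕ) : ℂ) ≠ 0 := by exact_mod_cast k.factorial_ne_zero
    rw [polylogCoeff, if_neg (by omega), Nat.cast_zero, zero_sub, riemannZeta_neg_nat_eq_bernoulli,
      Nat.factorial_succ]
    push_cast
    field_simp
    rw [← pow_mul]
    simp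
  have hexp : (fun u : ℝ => Real.exp u - 1 - Q.eval u) =O[𝓝[>] 0] fun u : ℝ => u ^ (K + 2) := by
    have h := (Real.exp_sub_sum_range_isBigO_pow (K + 2)).mono
      (nhdsWithin_le_nhds (s := Set.Ioi (0 : ℝ)))
    refine h.congr_left fun u => ?_
    rw [hQe]
    ring
  have hbd : ∀ p : Polynomial ℝ, (fun u : ℝ => p.eval u) =O[𝓝[>] 0] fun _ : ℝ => (1 : ℝ) := by
    intro p
    exact ((p.continuous.tendsto 0).mono_left nhdsWithin_le_nhds).isBigO_one ℝ
  have hnum : (fun u : ℝ => u - P.eval u * (Real.exp u - 1)) =O[𝓝[>] 0]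
      fun u : ℝ => u ^ (K + 2) := by
    have h1 := (hbd P).mul hexp
    have h2 := (hbd R).mul (isBigO_refl (fun u : ℝ => u ^ (K + 2)) (𝓝[>] 0))
    simp only [one_mul] at h1 h2
    refine (h1.add h2).neg_left.congr_left fun u => ?_
    have h3 := congrArg (Polynomial.eval u) hR
    simp only [Polynomial.eval_mul, Polynomial.eval_add, Polynomial.eval_X,
      Polynomial.eval_pow] at h3
    linear_combination h3
  obtain ⟨C, hC⟩ := hnum.bound
  refine IsBigO.of_bound C ?_
  filter_upwards [hC, self_mem_nhdsWithin] with u hu hu0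
  have hu1 : (0 : ℝ) < u := hu0
  have he : u ≤ Real.exp u - 1 := by linarith [Real.add_one_le_exp u]
  -- The numerator is `O(u^{K+2})` and the denominator is at least `u^2`, which leaves `u^K`.
  have heq : polylogRem 0 K u =
      (((u - P.eval u * (Real.exp u - 1)) / (u * (Real.exp u - 1)) : ℝ) : ℂ) := by
    have he' : ((Real.exp u - 1 : ℝ) : ℂ) ≠ 0 := by
      exact_mod_cast (hu1.trans_le he).ne'
    have hu' : (u : ℂ) ≠ 0 := by exact_mod_cast hu1.ne'
    rw [polylogRem, Nat.cast_zero, polylogExp_zero hu1, polylogSing, hPe]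
    simp_rw [hcoef]
    push_cast at he' ⊢
    field_simp
    ring
  rw [heq, Complex.norm_real, norm_div, div_le_iff₀ (by
    rw [norm_pos_iff]; exact (mul_pos hu1 (hu1.trans_le he)).ne')]
  refine hu.trans ?_
  have hC0 : 0 ≤ C := by
    by_contra hneg
    have h2 := norm_nonneg (u - P.eval u * (Real.exp u - 1))
    have h3 := mul_neg_of_neg_of_pos (not_le.1 hneg) (norm_pos_iff.2 (pow_pos hu1 (K + 2)).ne')
    linarith
  rw [mul_assoc]
  refine mul_le_mul_of_nonneg_left ?_ hC0
  rw [Real.norm_of_nonneg (by positivity), Real.norm_of_nonneg (by positivity),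
    Real.norm_of_nonneg (mul_nonneg hu1.le (hu1.le.trans he)), pow_add, pow_two]
  gcongr

/-- Each integration raises the order of the polylogarithm and the order of the remainder by one,
starting from the Bernoulli expansion. -/
theorem polylogRem_isBigO (r K : ℕ) :
    polylogRem r (K + r) =O[𝓝[>] 0] fun u : ℝ => u ^ (K + r) := by
  induction r with
  | zero => exact polylogRem_zero_isBigO K
  | succ r ih =>
    exact isBigO_pow_succ_of_hasDerivAt (fun u hu => hasDerivAt_polylogRem r (K + r) hu)
      ih.neg_left (tendsto_polylogRem r (K + r))

/-! ### Convergence of the double series, its analyticity in `t`, and its Mellin integral. -/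

theorem summable_prod_rpow {a b : ℝ} (ha : 1 < a) (hb : 1 < b) :
    Summable fun p : ℕ × ℕ => ((p.1 : ℝ) + 1) ^ (-a) * ((p.2 : ℝ) + 1) ^ (-b) :=
  (summable_natCast_add_one_rpow ha).mul_of_nonneg (summable_natCast_add_one_rpow hb)
    (fun _ => by positivity) (fun _ => by positivity)

theorem summable_mordellTornheim_rpow {ρ σ τ x : ℝ} (hx : 0 < x) (h1 : 1 < ρ + τ) (h2 : 1 < σ + τ)
    (h3 : 2 < ρ + σ + τ) :
    Summable fun p : ℕ × ℕ => ((p.1 : ℝ) + 1) ^ (-ρ) * ((p.2 : ℝ) + 1) ^ (-σ) *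
      (((p.1 : ℝ) + 1) + ((p.2 : ℝ) + 1) * x) ^ (-τ) := by
  rcases le_or_gt τ 0 with hτ | hτ
  · refine Summable.of_nonneg_of_le (fun p => by positivity) (fun p => ?_)
      (((summable_prod_rpow (a := ρ + τ) (b := σ) h1 (by linarith)).mul_left (2 ^ (-τ))).add
        ((summable_prod_rpow (a := ρ) (b := σ + τ) (by linarith) h2).mul_left (2 ^ (-τ) * x ^ (-τ))))
    have ha : (0 : ℝ) < (p.1 : ℝ) + 1 := by positivity
    have hb : (0 : ℝ) < (p.2 : ℝ) + 1 := by positivity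
    set a := (p.1 : ℝ) + 1
    set b := (p.2 : ℝ) + 1
    have hbx : 0 < b * x := by positivity
    have hle : (a + b * x) ^ (-τ) ≤ 2 ^ (-τ) * (a ^ (-τ) + (b * x) ^ (-τ)) := by
      have hτ' : 0 ≤ -τ := by linarith
      rw [mul_add, ← Real.mul_rpow two_pos.le ha.le, ← Real.mul_rpow two_pos.le hbx.le]
      have hpos1 : 0 ≤ (2 * a) ^ (-τ) := by positivity
      have hpos2 : 0 ≤ (2 * (b * x)) ^ (-τ) := by positivity
      rcases le_total a (b * x) with h | h
      · have := Real.rpow_le_rpow (by positivity) (show a + b * x ≤ 2 * (b * x) by linarith) hτ'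
        linarith
      · have := Real.rpow_le_rpow (by positivity) (show a + b * x ≤ 2 * a by linarith) hτ'
        linarith
    calc a ^ (-ρ) * b ^ (-σ) * (a + b * x) ^ (-τ)
        ≤ a ^ (-ρ) * b ^ (-σ) * (2 ^ (-τ) * (a ^ (-τ) + (b * x) ^ (-τ))) := by gcongr
      _ = _ := by
        rw [neg_add, Real.rpow_add ha, neg_add, Real.rpow_add hb, Real.mul_rpow hb.le hx.le]
        ring
  -- For `τ > 0` the exponent is shared out as `(a + bx)^{-τ} ≤ a^{-β} (bx)^{-(τ-β)}`. The three
  -- convergence conditions, with `τ > 0`, say that a suitable `β` exists.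
  · obtain ⟨β, hβ1, hβ2⟩ : ∃ β, max 0 (1 - ρ) < β ∧ β < min τ (σ + τ - 1) := by
      refine exists_between (max_lt (lt_min hτ (by linarith)) (lt_min (by linarith) (by linarith)))
    rw [max_lt_iff] at hβ1
    rw [lt_min_iff] at hβ2
    refine Summable.of_nonneg_of_le (fun p => by positivity) (fun p => ?_)
      ((summable_prod_rpow (a := ρ + β) (b := σ + (τ - β)) (by linarith) (by linarith)).mul_left
        (x ^ (-(τ - β))))
    have ha : (0 : ℝ) < (p.1 : ℝ) + 1 := by positivity
    have hb : (0 : ℝ) < (p.2 : ℝ) + 1 := by positivity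
    set a := (p.1 : ℝ) + 1
    set b := (p.2 : ℝ) + 1
    have hbx : 0 < b * x := by positivity
    have hab : 0 < a + b * x := by positivity
    have hle : (a + b * x) ^ (-τ) ≤ a ^ (-β) * (b * x) ^ (-(τ - β)) := by
      rw [show -τ = -β + -(τ - β) by ring, Real.rpow_add hab]
      have e1 := Real.rpow_le_rpow_of_nonpos ha (show a ≤ a + b * x by linarith)
        (show -β ≤ 0 by linarith)
      have e2 := Real.rpow_le_rpow_of_nonpos hbx (show b * x ≤ a + b * x by linarith)
        (show -(τ - β) ≤ 0 by linarith)
      gcongr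
    calc a ^ (-ρ) * b ^ (-σ) * (a + b * x) ^ (-τ)
        ≤ a ^ (-ρ) * b ^ (-σ) * (a ^ (-β) * (b * x) ^ (-(τ - β))) := by gcongr
      _ = _ := by
        rw [neg_add, Real.rpow_add ha, neg_add, Real.rpow_add hb, Real.mul_rpow hb.le hx.le]
        ring

theorem norm_thetaTerm (r s t : ℂ) {x : ℝ} (hx : 0 < x) (p : ℕ × ℕ) :
    ‖thetaTerm r s t x p‖ = ((p.1 : ℝ) + 1) ^ (-r.re) * ((p.2 : ℝ) + 1) ^ (-s.re) *
      (((p.1 : ℝ) + 1) + ((p.2 : ℝ) + 1) * x) ^ (-t.re) := by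
  have h : ((p.1 : ℂ) + 1) + ((p.2 : ℂ) + 1) * (x : ℂ) =
      ((((p.1 : ℝ) + 1) + ((p.2 : ℝ) + 1) * x : ℝ) : ℂ) := by push_cast; rfl
  rw [thetaTerm, h, norm_div, norm_mul, norm_mul, norm_natCast_add_one_cpow,
    norm_natCast_add_one_cpow, Complex.norm_cpow_eq_rpow_re_of_pos (by positivity), norm_one,
    Real.rpow_neg (by positivity), Real.rpow_neg (by positivity), Real.rpow_neg (by positivity)]
  simp only [one_div, mul_inv]

theorem summable_norm_thetaTerm {r s t : ℂ} {x : ℝ} (hx : 0 < x) (h : thetaRegion r s t) :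
    Summable fun p => ‖thetaTerm r s t x p‖ := by
  simp_rw [norm_thetaTerm r s t hx]
  obtain ⟨h1, h2, h3⟩ := h
  simp only [Complex.add_re] at h1 h2 h3
  exact summable_mordellTornheim_rpow hx h1 h2 h3

theorem norm_thetaTerm_le {r s t t' : ℂ} {x : ℝ} (hx : 0 < x) (h : t.re ≤ t'.re) (p : ℕ × ℕ) :
    ‖thetaTerm r s t' x p‖ ≤ ‖thetaTerm r s t x p‖ := by
  rw [norm_thetaTerm _ _ _ hx, norm_thetaTerm _ _ _ hx]
  have : (1 : ℝ) ≤ ((p.1 : ℝ) + 1) + ((p.2 : ℝ) + 1) * x := by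
    have h1 : (0 : ℝ) ≤ p.1 := by positivity
    have h2 : (0 : ℝ) ≤ ((p.2 : ℝ) + 1) * x := by positivity
    linarith
  gcongr

/-- Pick a real `τ < Re t` still in the region. As `n + mx ≥ 1`, the term norms decrease in `Re t`,
so the series at `τ` dominates on `Re z > τ` and Weierstrass applies. -/
theorem differentiableAt_tsum_thetaTerm {r s t : ℂ} {x : ℝ} (hx : 0 < x) (h : thetaRegion r s t) :
    DifferentiableAt ℂ (fun t => ∑' p, thetaTerm r s t x p) t := by
  obtain ⟨h1, h2, h3⟩ := h
  simp only [Complex.add_re] at h1 h2 h3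
  obtain ⟨τ, hτ1, hτ2⟩ : ∃ τ : ℝ, max (max (1 - r.re) (1 - s.re)) (2 - r.re - s.re) < τ ∧ τ < t.re :=
    exists_between (max_lt (max_lt (by linarith) (by linarith)) (by linarith))
  simp only [max_lt_iff] at hτ1
  have hreg : thetaRegion r s (τ : ℂ) := by
    simp only [thetaRegion, Complex.add_re, Complex.ofReal_re]
    exact ⟨by linarith, by linarith, by linarith⟩
  have hopen : IsOpen {z : ℂ | τ < z.re} := isOpen_lt continuous_const Complex.continuous_re
  have hd := Complex.differentiableOn_tsum_of_summable_norm
    (F := fun p t => thetaTerm r s t x p) (summable_norm_thetaTerm hx hreg)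
    (U := {z : ℂ | τ < z.re}) ?_ hopen ?_
  · exact (hd t hτ2).differentiableAt (hopen.mem_nhds hτ2)
  · intro p
    have hne : ((p.1 : ℂ) + 1) + ((p.2 : ℂ) + 1) * (x : ℂ) ≠ 0 := by
      have h : ((p.1 : ℂ) + 1) + ((p.2 : ℂ) + 1) * (x : ℂ) =
        ((((p.1 : ℝ) + 1) + ((p.2 : ℝ) + 1) * x : ℝ) : ℂ) := by push_cast; rfl
      rw [h, Complex.ofReal_ne_zero]
      positivity
    have hn1 := Nat.cast_add_one_ne_zero (R := ℂ) p.1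
    have hn2 := Nat.cast_add_one_ne_zero (R := ℂ) p.2
    refine Differentiable.differentiableOn fun z => ?_
    unfold thetaTerm
    refine DifferentiableAt.div (by fun_prop) ?_ ?_
    · exact ((differentiableAt_id).const_cpow (Or.inl hne)).const_mul _
    · simp [Complex.cpow_eq_zero_iff, hne, hn1, hn2]
  · intro p z hz
    exact norm_thetaTerm_le hx (by simpa using (le_of_lt hz)) p

/-- Multiplying the two exponential series gives `e^{-(n+mx)u}`, whose Mellin transform is `Γ(t)
(n+mx)^{-t}`. -/
theorem hasSum_thetaTerm_mellin {r s t : ℂ} {x : ℝ} (hx : 0 < x) (ht : 0 < t.re)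
    (h : thetaRegion r s t) :
    HasSum (thetaTerm r s t x)
      (mellin (fun u => polylogExp r u * polylogExp s (x * u)) t / Complex.Gamma t) := by
  have key := hasSum_mellin (ι := ℕ × ℕ)
    (a := fun p => ((p.1 : ℂ) + 1) ^ (-r) * ((p.2 : ℂ) + 1) ^ (-s))
    (p := fun p => ((p.1 : ℝ) + 1) + ((p.2 : ℝ) + 1) * x)
    (F := fun u => polylogExp r u * polylogExp s (x * u)) (s := t)
    (fun p => Or.inr (by positivity)) ht ?_ ?_
  · have hG : Complex.Gamma t ≠ 0 := Complex.Gamma_ne_zero_of_re_pos ht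
    convert! key.div_const (Complex.Gamma t) using 2 with p
    rw [thetaTerm, Complex.cpow_neg, Complex.cpow_neg]
    push_cast
    rw [mul_div_assoc, mul_div_cancel_left₀ _ hG]
    field_simp
  · intro u hu
    have hu0 : 0 < u := hu
    have hxu : 0 < x * u := mul_pos hx hu0
    have h1 := summable_polylogExp r hu0
    have h2 := summable_polylogExp s hxu
    have h3 := summable_mul_of_summable_norm h1.norm h2.norm
    have h4 := h3.hasSum
    rw [← tsum_mul_tsum_of_summable_norm h1.norm h2.norm] at h4
    convert! h4 using 2 with p
    rw [show -(((p.1 : ℝ) + 1) + ((p.2 : ℝ) + 1) * x) * u =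
      -((p.1 : ℝ) + 1) * u + -((p.2 : ℝ) + 1) * (x * u) by ring, Real.exp_add]
    push_cast
    ring
  · refine (summable_norm_thetaTerm hx h).congr fun p => ?_
    rw [norm_thetaTerm _ _ _ hx, norm_mul, norm_natCast_add_one_cpow, norm_natCast_add_one_cpow,
      Real.rpow_neg (by positivity : (0 : ℝ) ≤ ((p.1 : ℝ) + 1) + ((p.2 : ℝ) + 1) * x)]
    simp [div_eq_mul_inv]

/-! ### Mellin transforms of the pieces of the expansion. -/

/-- The Mellin transform of `u ↦ Li_s(exp (-x u))`. -/
noncomputable def gammaZeta (s : ℂ) (x : ℝ) (z : ℂ) : ℂ :=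
  Complex.Gamma z * (x : ℂ) ^ (-z) * riemannZeta (s + z)

theorem mellin_polylogExp {s z : ℂ} (hz : 0 < z.re) (hsz : 1 < (s + z).re) :
    mellin (polylogExp s) z = Complex.Gamma z * riemannZeta (s + z) := by
  have key := hasSum_mellin (ι := ℕ) (a := fun n => ((n : ℂ) + 1) ^ (-s))
    (p := fun n => (n : ℝ) + 1) (F := polylogExp s) (s := z)
    (fun p => Or.inr (by positivity)) hz (fun u hu => (summable_polylogExp s hu).hasSum) ?_
  · rw [← key.tsum_eq, zeta_eq_tsum_one_div_nat_add_one_cpow hsz, ← tsum_mul_left]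
    refine tsum_congr fun n => ?_
    rw [Complex.cpow_add _ _ (Nat.cast_add_one_ne_zero n), Complex.cpow_neg]
    push_cast
    field_simp
  · refine (summable_natCast_add_one_rpow hsz).congr fun n => ?_
    rw [norm_natCast_add_one_cpow, Complex.add_re, neg_add, Real.rpow_add (by positivity),
      Real.rpow_neg (by positivity) z.re]
    simp [div_eq_mul_inv]

theorem polylogExp_isBigO_zero (s : ℂ) {x : ℝ} (hx : 0 < x) {A : ℕ} (hA : 1 < s.re + A) :
    (fun u => polylogExp s (x * u)) =O[𝓝[>] 0] fun u : ℝ => u ^ (-(A : ℝ)) := by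
  obtain ⟨C, hC⟩ := exists_norm_polylogExp_le s hA
  refine IsBigO.of_bound (C * x ^ (-(A : ℝ))) ?_
  filter_upwards [self_mem_nhdsWithin] with u hu
  have hu0 : 0 < u := hu
  refine (hC _ (mul_pos hx hu)).trans (le_of_eq ?_)
  rw [Real.mul_rpow hx.le hu0.le, Real.norm_of_nonneg (by positivity), mul_assoc]

theorem polylogExp_isBigO_atTop (s : ℂ) {x : ℝ} (hx : 0 < x) (a : ℝ) :
    (fun u => polylogExp s (x * u)) =O[atTop] fun u : ℝ => u ^ a := by
  obtain ⟨A, hA⟩ := exists_nat_gt (max (1 - s.re) (-a))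
  rw [max_lt_iff] at hA
  obtain ⟨C, hC⟩ := exists_norm_polylogExp_le s (A := A) (by linarith)
  refine IsBigO.trans (g := fun u : ℝ => u ^ (-(A : ℝ))) (IsBigO.of_bound (C * x ^ (-(A : ℝ))) ?_) ?_
  · filter_upwards [eventually_gt_atTop 0] with u hu
    refine (hC _ (mul_pos hx hu)).trans (le_of_eq ?_)
    rw [Real.mul_rpow hx.le hu.le, Real.norm_of_nonneg (by positivity), mul_assoc]
  · refine IsBigO.of_bound 1 ?_
    filter_upwards [eventually_ge_atTop 1] with u hu
    have hu0 : 0 < u := by linarith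
    rw [Real.norm_of_nonneg (by positivity), Real.norm_of_nonneg (by positivity), one_mul]
    exact Real.rpow_le_rpow_of_exponent_le hu (by linarith)

theorem continuousOn_polylogExp_mul (s : ℂ) {x : ℝ} (hx : 0 < x) :
    ContinuousOn (fun u => polylogExp s (x * u)) (Set.Ioi 0) :=
  (continuousOn_polylogExp s).comp (by fun_prop) fun _ hu => mul_pos hx hu

theorem hasMellin_polylogExp {s z : ℂ} {x : ℝ} (hx : 0 < x) {A : ℕ} (hA : 1 < s.re + A)
    (hz : A < z.re) :
    HasMellin (fun u => polylogExp s (x * u)) z (gammaZeta s x z) := by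
  refine ⟨mellinConvergent_of_isBigO_rpow (a := z.re + 1)
    ((continuousOn_polylogExp_mul s hx).locallyIntegrableOn measurableSet_Ioi)
    (polylogExp_isBigO_atTop s hx _) (by linarith) (polylogExp_isBigO_zero s hx hA) hz, ?_⟩
  have hz0 : 0 < z.re := lt_of_le_of_lt (Nat.cast_nonneg A) hz
  rw [mellin_comp_mul_left _ _ hx, mellin_polylogExp hz0 (by rw [Complex.add_re]; linarith),
    gammaZeta, smul_eq_mul]
  ring

/-- A logarithm under the integral is a derivative in the Mellin variable. -/
theorem hasMellin_log_polylogExp {s z : ℂ} {x : ℝ} (hx : 0 < x) {A : ℕ} (hA : 1 < s.re + A)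
    (hz : A < z.re) :
    HasMellin (fun u => (Real.log u : ℂ) * polylogExp s (x * u)) z (deriv (gammaZeta s x) z) := by
  obtain ⟨h1, h2⟩ := mellin_hasDerivAt_of_isBigO_rpow (a := z.re + 1)
    ((continuousOn_polylogExp_mul s hx).locallyIntegrableOn measurableSet_Ioi)
    (polylogExp_isBigO_atTop s hx _) (by linarith) (polylogExp_isBigO_zero s hx hA) hz
  have he : mellin (fun u => polylogExp s (x * u)) =ᶠ[𝓝 z] gammaZeta s x := by
    filter_upwards [(isOpen_lt continuous_const Complex.continuous_re).mem_nhds hz] with w hw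
    exact (hasMellin_polylogExp hx hA hw).2
  simp only [Complex.real_smul] at h1 h2
  exact ⟨h1, by rw [← he.deriv_eq, h2.deriv]⟩

theorem HasMellin.pow_mul {f : ℝ → ℂ} {z m : ℂ} {k : ℕ} (h : HasMellin f (z + k) m) :
    HasMellin (fun u => (u : ℂ) ^ k * f u) z m := by
  refine ⟨?_, ?_⟩
  · simpa [Complex.cpow_natCast] using MellinConvergent.cpow_smul.2 h.1
  · simpa [Complex.cpow_natCast] using (mellin_cpow_smul f z (k : ℂ)).trans h.2

theorem HasMellin.finset_sum {ι : Type*} (S : Finset ι) {f : ι → ℝ → ℂ} {z : ℂ} {m : ι → ℂ}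
    (h : ∀ i ∈ S, HasMellin (f i) z (m i)) :
    HasMellin (fun u => ∑ i ∈ S, f i u) z (∑ i ∈ S, m i) := by
  classical
  induction S using Finset.induction_on with
  | empty =>
    refine ⟨?_, ?_⟩ <;> simp [MellinConvergent, mellin]
  | insert i S hi ih =>
    simp only [Finset.sum_insert hi]
    have h1 := h i (Finset.mem_insert_self i S)
    have h2 := ih fun j hj => h j (Finset.mem_insert_of_mem hj)
    have h3 := hasMellin_add h1.1 h2.1
    rwa [h1.2, h2.2] at h3

theorem HasMellin.const_mul {f : ℝ → ℂ} {z m : ℂ} (c : ℂ) (h : HasMellin f z m) :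
    HasMellin (fun u => c * f u) z (c * m) := by
  have h3 := hasMellin_const_smul h.1 c
  rwa [h.2] at h3

theorem HasMellin.sub {f g : ℝ → ℂ} {z m n : ℂ} (hf : HasMellin f z m) (hg : HasMellin g z n) :
    HasMellin (fun u => f u - g u) z (m - n) := by
  have h3 := hasMellin_sub hf.1 hg.1
  rwa [hf.2, hg.2] at h3

/-- The part of the continued Mellin transform of `polylogExp (r + 1) u * polylogExp s (x * u)`
which comes from the expansion of the first factor at the origin. -/
noncomputable def thetaPolar (r : ℕ) (s : ℂ) (x : ℝ) (K : ℕ) (z : ℂ) : ℂ :=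
  ∑ k ∈ Finset.range K, polylogCoeff (r + 1) k * gammaZeta s x (z + k) +
    (-1) ^ r / r.factorial *
      ((harmonic r : ℂ) * gammaZeta s x (z + r) - deriv (gammaZeta s x) (z + r))

/-- The part of the continued Mellin transform of `polylogExp (r + 1) u * polylogExp s (x * u)`
which comes from the remainder in the expansion of the first factor. -/
noncomputable def thetaRem (r : ℕ) (s : ℂ) (x : ℝ) (K : ℕ) (z : ℂ) : ℂ :=
  mellin (fun u => polylogRem (r + 1) K u * polylogExp s (x * u)) z

theorem polylogExp_isBigO_zero_rpow_neg_one (r : ℕ) :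
    polylogExp (r + 1 : ℕ) =O[𝓝[>] 0] fun u : ℝ => u ^ (-((1 : ℕ) : ℝ)) := by
  have h := polylogExp_isBigO_zero ((r + 1 : ℕ) : ℂ) one_pos (A := 1) (by
    rw [Complex.natCast_re]
    push_cast
    linarith [(Nat.cast_nonneg r : (0 : ℝ) ≤ r)])
  simpa using h

/-- In this half-plane every piece converges separately; the extra `1` in the bound on `Re z` pays
for `Li_{r+1}(e^{-u}) = O(u^{-1})`. -/
theorem mellin_eq_thetaPolar_add_thetaRem (r : ℕ) {s z : ℂ} {x : ℝ} (hx : 0 < x) (K : ℕ) {A : ℕ}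
    (hA : 1 < s.re + A) (hz : A + 1 < z.re) :
    mellin (fun u => polylogExp (r + 1 : ℕ) u * polylogExp s (x * u)) z =
      thetaPolar r s x K z + thetaRem r s x K z := by
  have hk : ∀ k : ℕ, (A : ℝ) < (z + k).re := by
    intro k
    rw [Complex.add_re, Complex.natCast_re]
    linarith [(Nat.cast_nonneg k : (0 : ℝ) ≤ k)]
  have hmain : HasMellin (fun u => polylogExp (r + 1 : ℕ) u * polylogExp s (x * u)) z
      (mellin (fun u => polylogExp (r + 1 : ℕ) u * polylogExp s (x * u)) z) := by
    refine ⟨mellinConvergent_of_isBigO_rpow (a := z.re + 1) (b := A + 1)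
      (((continuousOn_polylogExp _).mul (continuousOn_polylogExp_mul s hx)).locallyIntegrableOn
        measurableSet_Ioi) ?_ (by linarith) ?_ hz, rfl⟩
    · have h1 := polylogExp_isBigO_atTop ((r + 1 : ℕ) : ℂ) one_pos 0
      have h2 := h1.mul (polylogExp_isBigO_atTop s hx (-(z.re + 1)))
      simpa using h2
    · refine ((polylogExp_isBigO_zero_rpow_neg_one r).mul (polylogExp_isBigO_zero s hx hA)).congr'
        (Eventually.of_forall fun _ => rfl) ?_
      filter_upwards [self_mem_nhdsWithin] with u hu
      rw [← Real.rpow_add hu]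
      push_cast
      ring_nf
  have hsum := HasMellin.finset_sum (Finset.range K) (z := z) fun k _ =>
    ((hasMellin_polylogExp hx hA (hk k)).pow_mul).const_mul (polylogCoeff (r + 1) k)
  have hsing := ((((hasMellin_polylogExp hx hA (hk r)).const_mul (harmonic r : ℂ)).sub
    (hasMellin_log_polylogExp hx hA (hk r))).pow_mul).const_mul ((-1) ^ r / (r.factorial : ℂ))
  have htot := ((hmain.sub hsing).sub hsum).2
  have he : thetaRem r s x K z = mellin (fun u => polylogExp (r + 1 : ℕ) u * polylogExp s (x * u) -
      (-1) ^ r / (r.factorial : ℂ) * ((u : ℂ) ^ r * ((harmonic r : ℂ) * polylogExp s (x * u) -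
        (Real.log u : ℂ) * polylogExp s (x * u))) -
      ∑ k ∈ Finset.range K, polylogCoeff (r + 1) k * ((u : ℂ) ^ k * polylogExp s (x * u))) z := by
    unfold thetaRem
    congr 1
    funext u
    rw [polylogRem, sub_mul, Finset.sum_mul]
    congr 1
    · rw [polylogSing, neg_pow (u : ℂ)]
      ring
    · exact Finset.sum_congr rfl fun k _ => by ring
  rw [he, htot, thetaPolar]
  ring

/-- Polynomial growth at infinity is harmless, since `Li_s(e^{-xu})` decays faster than any power.
-/
theorem polylogRem_isBigO_atTop (r K : ℕ) :
    polylogRem (r + 1) (K + (r + 1)) =O[atTop] fun u : ℝ => u ^ ((K + r + 1 : ℕ) : ℝ) := by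
  have hpow : ∀ k : ℕ, k ≤ K + r + 1 →
      (fun u : ℝ => (u : ℂ) ^ k) =O[atTop] fun u : ℝ => u ^ ((K + r + 1 : ℕ) : ℝ) := by
    intro k hk
    refine IsBigO.of_bound 1 ?_
    filter_upwards [eventually_ge_atTop 1] with u hu
    rw [norm_pow, Complex.norm_real, ← norm_pow, Real.rpow_natCast,
      Real.norm_of_nonneg (by positivity), Real.norm_of_nonneg (by positivity), one_mul]
    exact pow_le_pow_right₀ hu hk
  have h1 : polylogExp (r + 1 : ℕ) =O[atTop] fun u : ℝ => u ^ ((K + r + 1 : ℕ) : ℝ) := by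
    simpa using polylogExp_isBigO_atTop ((r + 1 : ℕ) : ℂ) one_pos ((K + r + 1 : ℕ) : ℝ)
  have hlog : (fun u : ℝ => (harmonic r : ℂ) - (Real.log u : ℂ)) =O[atTop] fun u : ℝ => u := by
    have e1 : (fun _ : ℝ => (harmonic r : ℂ)) =O[atTop] fun u : ℝ => u :=
      (isLittleO_const_id_atTop _).isBigO
    have e2 : (fun u : ℝ => (Real.log u : ℂ)) =O[atTop] fun u : ℝ => u :=
      Complex.isBigO_ofReal_left.2 Real.isLittleO_log_id_atTop.isBigO
    exact e1.sub e2
  have h2 : polylogSing (r + 1) =O[atTop] fun u : ℝ => u ^ ((K + r + 1 : ℕ) : ℝ) := by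
    have e1 : (fun u : ℝ => (-(u : ℂ)) ^ r / r.factorial) =O[atTop] fun u : ℝ => u ^ r := by
      refine IsBigO.of_bound 1 (Eventually.of_forall fun u => ?_)
      rw [norm_div, norm_pow, norm_neg, Complex.norm_real, Complex.norm_natCast, norm_pow, one_mul]
      exact div_le_self (by positivity) (by exact_mod_cast r.factorial_pos)
    refine (e1.mul hlog).trans (IsBigO.of_bound 1 ?_)
    filter_upwards [eventually_ge_atTop 1] with u hu
    rw [← pow_succ, Real.rpow_natCast, Real.norm_of_nonneg (by positivity),
      Real.norm_of_nonneg (by positivity), one_mul]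
    exact pow_le_pow_right₀ hu (by omega)
  refine (h1.sub h2).sub (IsBigO.fun_sum fun k hk => ?_)
  exact (hpow k (by have := Finset.mem_range.1 hk; omega)).const_mul_left _

theorem continuousOn_polylogRem (r K : ℕ) : ContinuousOn (polylogRem (r + 1) K) (Set.Ioi 0) := by
  have h2 : ContinuousOn (polylogSing (r + 1)) (Set.Ioi 0) := fun u hu =>
    (hasDerivAt_polylogSing r hu).continuousAt.continuousWithinAt
  exact ((continuousOn_polylogExp _).sub h2).sub (Continuous.continuousOn (by fun_prop))

/-- Near `0` the integrand is `O(u^{K+r+1-A})`, which sets the left edge of the half-plane; it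
recedes as `K` grows. -/
theorem differentiableAt_thetaRem (r K : ℕ) {s z : ℂ} {x : ℝ} (hx : 0 < x) {A : ℕ}
    (hA : 1 < s.re + A) (hz : (A : ℝ) - (K + r + 1 : ℕ) < z.re) :
    DifferentiableAt ℂ (thetaRem r s x (K + (r + 1))) z := by
  refine mellin_differentiableAt_of_isBigO_rpow (a := z.re + 1) (b := A - (K + r + 1 : ℕ))
    (((continuousOn_polylogRem r _).mul (continuousOn_polylogExp_mul s hx)).locallyIntegrableOn
      measurableSet_Ioi) ?_ (by linarith) ?_ hz
  · refine ((polylogRem_isBigO_atTop r K).mul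
      (polylogExp_isBigO_atTop s hx (-(z.re + 1) - ((K + r + 1 : ℕ) : ℝ)))).congr'
      (Eventually.of_forall fun _ => rfl) ?_
    filter_upwards [eventually_gt_atTop 0] with u hu
    rw [← Real.rpow_add hu]
    ring_nf
  · refine ((polylogRem_isBigO (r + 1) K).mul (polylogExp_isBigO_zero s hx hA)).congr'
      (Eventually.of_forall fun _ => rfl) ?_
    filter_upwards [self_mem_nhdsWithin] with u hu
    rw [← Real.rpow_natCast, ← Real.rpow_add hu]
    push_cast
    ring_nf

/-! ### Meromorphic continuation of `Θ` in `t`. -/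

/-- Identity theorem for meromorphic functions. -/
theorem MeromorphicOn.eventuallyEq_nhdsNE_of_isPreconnected {f g : ℂ → ℂ} {U : Set ℂ}
    (hf : MeromorphicOn f U) (hg : MeromorphicOn g U) (hU : IsPreconnected U) {z w : ℂ}
    (hz : z ∈ U) (hw : w ∈ U) (h : f =ᶠ[𝓝[≠] z] g) : f =ᶠ[𝓝[≠] w] g := by
  have hz' : meromorphicOrderAt (f - g) z = ⊤ := by
    rw [meromorphicOrderAt_eq_top_iff]
    filter_upwards [h] with y hy
    simp [hy]
  have hw' : meromorphicOrderAt (f - g) w = ⊤ := by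
    by_contra hne
    exact (hf.sub hg).meromorphicOrderAt_ne_top_of_isPreconnected hU hw hz hne hz'
  rw [meromorphicOrderAt_eq_top_iff] at hw'
  filter_upwards [hw'] with y hy
  exact sub_eq_zero.1 hy

theorem isPreconnected_re_gt (a : ℝ) : IsPreconnected {z : ℂ | a < z.re} :=
  (convex_halfSpace_re_gt a).isPreconnected

theorem isOpen_re_gt (a : ℝ) : IsOpen {z : ℂ | a < z.re} :=
  isOpen_lt continuous_const Complex.continuous_re

theorem re_gt_mem_nhds {a : ℝ} {z : ℂ} (hz : a < z.re) : {w : ℂ | a < w.re} ∈ 𝓝 z :=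
  (isOpen_re_gt a).mem_nhds hz

/-- Two functions which are meromorphic on a half-plane and agree far to the right are equal off a
discrete set. -/
theorem eventuallyEq_nhdsNE_of_eqOn_halfPlane {f g : ℂ → ℂ} {a c : ℝ}
    (hf : MeromorphicOn f {z : ℂ | a < z.re}) (hg : MeromorphicOn g {z : ℂ | a < z.re})
    (h : ∀ z : ℂ, c < z.re → f z = g z) {w : ℂ} (hw : a < w.re) : f =ᶠ[𝓝[≠] w] g := by
  have hz : max a c < (((max a c + 1 : ℝ) : ℂ)).re := by simp
  refine hf.eventuallyEq_nhdsNE_of_isPreconnected hg (isPreconnected_re_gt a)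
    (z := ((max a c + 1 : ℝ) : ℂ)) ((le_max_left a c).trans_lt hz) hw ?_
  refine Filter.Eventually.filter_mono nhdsWithin_le_nhds ?_
  filter_upwards [re_gt_mem_nhds ((le_max_right a c).trans_lt hz)] with y hy using h y hy

/-- Functions which are meromorphic on larger and larger half-planes and agree far to the right
have a common meromorphic continuation. -/
theorem exists_meromorphic_of_halfPlanes {G : ℕ → ℂ → ℂ} {a c : ℝ}
    (hG : ∀ n : ℕ, MeromorphicOn (G n) {z : ℂ | a - n < z.re})
    (h : ∀ (n m : ℕ) (z : ℂ), c < z.re → G n z = G m z) :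
    ∃ F : ℂ → ℂ, (∀ z, MeromorphicNFAt F z) ∧
      ∀ (n : ℕ) (z : ℂ), a - n < z.re → F =ᶠ[𝓝[≠] z] G n := by
  have hN : ∀ z : ℂ, a - (⌈a - z.re⌉₊ + 1 : ℕ) < z.re := by
    intro z
    have := Nat.le_ceil (a - z.re)
    push_cast
    linarith
  have hcompat : ∀ (n m : ℕ) (z : ℂ), a - n < z.re → a - m < z.re → G n =ᶠ[𝓝[≠] z] G m := by
    intro n m z hn hm
    refine eventuallyEq_nhdsNE_of_eqOn_halfPlane (a := max (a - n) (a - m)) (c := c) ?_ ?_ (h n m)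
      (max_lt hn hm)
    · exact (hG n).mono_set fun y (hy : max (a - n) (a - m) < y.re) => show a - n < y.re from
        (le_max_left _ _).trans_lt hy
    · exact (hG m).mono_set fun y (hy : max (a - n) (a - m) < y.re) => show a - m < y.re from
        (le_max_right _ _).trans_lt hy
  -- The index is chosen so that `z` lies in the corresponding half-plane. Passing to the normal
  -- form makes the value at `z` independent of that choice.
  let F : ℂ → ℂ := fun z => toMeromorphicNFAt (G (⌈a - z.re⌉₊ + 1)) z z
  have hF : ∀ (n : ℕ) (z : ℂ), a - n < z.re →
      F =ᶠ[𝓝 z] toMeromorphicNFOn (G n) {z : ℂ | a - n < z.re} := by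
    intro n z hz
    filter_upwards [re_gt_mem_nhds hz] with w hw
    rw [toMeromorphicNFOn_eq_toMeromorphicNFAt (hG n) hw]
    exact (toMeromorphicNFAt_eventuallyEq_nhds_congr (hcompat _ n w (hN w) hw)).eq_of_nhds
  refine ⟨F, fun z => ?_, fun n z hz => ?_⟩
  · rw [meromorphicNFAt_congr (hF _ z (hN z))]
    exact meromorphicNFOn_toMeromorphicNFOn _ _ (hN z)
  · exact ((hF n z hz).filter_mono nhdsWithin_le_nhds).trans
      ((hG n).toMeromorphicNFOn_eq_self_on_nhdsNE hz)

/-- The regular part of the Riemann zeta function at `1`. -/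
theorem exists_analyticAt_riemannZeta_one : ∃ g : ℂ → ℂ, AnalyticAt ℂ g 1 ∧
    g 1 = Real.eulerMascheroniConstant ∧ ∀ z, z ≠ 1 → riemannZeta z = 1 / (z - 1) + g z := by
  classical
  refine ⟨Function.update (fun z => riemannZeta z - 1 / (z - 1)) 1 Real.eulerMascheroniConstant,
    ?_, by simp, fun z hz => by simp [Function.update_of_ne hz]⟩
  refine Complex.analyticAt_of_differentiable_on_punctured_nhds_of_continuousAt ?_ ?_
  · filter_upwards [self_mem_nhdsWithin] with z hz
    have hz1 : z ≠ 1 := hz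
    have hd : DifferentiableAt ℂ (fun z => riemannZeta z - 1 / (z - 1)) z :=
      (differentiableAt_riemannZeta hz1).sub
        ((differentiableAt_const _).div (by fun_prop) (sub_ne_zero.2 hz1))
    refine hd.congr_of_eventuallyEq ?_
    filter_upwards [isOpen_ne.mem_nhds hz1] with w hw
    simp [Function.update_of_ne hw]
  · exact continuousAt_update_same.2 tendsto_riemannZeta_sub_one_div

theorem analyticAt_riemannZeta {z : ℂ} (hz : z ≠ 1) : AnalyticAt ℂ riemannZeta z := by
  refine DifferentiableOn.analyticAt (s := {1}ᶜ) (fun w hw => ?_) (isOpen_ne.mem_nhds hz)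
  exact (differentiableAt_riemannZeta hw).differentiableWithinAt

theorem meromorphic_riemannZeta : Meromorphic riemannZeta := by
  intro z
  by_cases hz : z = 1
  · subst hz
    obtain ⟨g, hg, _, h⟩ := exists_analyticAt_riemannZeta_one
    have h1 : MeromorphicAt (fun z : ℂ => 1 / (z - 1) + g z) 1 :=
      ((MeromorphicAt.const 1 1).div ((MeromorphicAt.id 1).sub (MeromorphicAt.const 1 1))).add
        hg.meromorphicAt
    refine h1.congr ?_
    filter_upwards [self_mem_nhdsWithin] with w hw using (h w hw).symm
  · exact (analyticAt_riemannZeta hz).meromorphicAt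

theorem MeromorphicAt.comp_add_const' {f : ℂ → ℂ} {z c : ℂ} (h : MeromorphicAt f (z + c)) :
    MeromorphicAt (fun w => f (w + c)) z :=
  h.comp_analyticAt (g := fun w => w + c) (by fun_prop)

theorem analyticAt_ofReal_cpow_neg {x : ℝ} (hx : 0 < x) (z : ℂ) :
    AnalyticAt ℂ (fun z : ℂ => (x : ℂ) ^ (-z)) z := by
  have hx' : (x : ℂ) ≠ 0 := by exact_mod_cast hx.ne'
  refine Differentiable.analyticAt (fun w => ?_) z
  exact (differentiableAt_id.neg).const_cpow (Or.inl hx')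

theorem meromorphic_gammaZeta (s : ℂ) {x : ℝ} (hx : 0 < x) : Meromorphic (gammaZeta s x) := by
  intro z
  have h : MeromorphicAt (fun w => riemannZeta (w + s)) z := (meromorphic_riemannZeta _).comp_add_const'
  simp_rw [add_comm _ s] at h
  exact ((Meromorphic.Gamma z).mul (analyticAt_ofReal_cpow_neg hx z).meromorphicAt).mul h

theorem meromorphic_thetaPolar (r : ℕ) (s : ℂ) {x : ℝ} (hx : 0 < x) (K : ℕ) :
    Meromorphic (thetaPolar r s x K) := by
  intro z
  have h1 : ∀ k : ℕ, MeromorphicAt (fun w => gammaZeta s x (w + k)) z := fun k =>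
    (meromorphic_gammaZeta s hx _).comp_add_const'
  have h2 : MeromorphicAt (fun w => deriv (gammaZeta s x) (w + r)) z :=
    ((meromorphic_gammaZeta s hx).deriv _).comp_add_const'
  unfold thetaPolar
  refine MeromorphicAt.add (MeromorphicAt.fun_sum fun k _ => ?_) ?_
  · exact (MeromorphicAt.const _ _).mul (h1 k)
  · exact (MeromorphicAt.const _ _).mul (((MeromorphicAt.const _ _).mul (h1 r)).sub h2)

theorem analyticAt_thetaRem (r K : ℕ) {s z : ℂ} {x : ℝ} (hx : 0 < x) {A : ℕ}
    (hA : 1 < s.re + A) (hz : (A : ℝ) - (K + r + 1 : ℕ) < z.re) :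
    AnalyticAt ℂ (thetaRem r s x (K + (r + 1))) z :=
  DifferentiableOn.analyticAt (fun _ hw => (differentiableAt_thetaRem r K hx hA
    hw).differentiableWithinAt) (re_gt_mem_nhds hz)

/-- The continuation of `t ↦ Θ(r + 1, s, t, x)` to a half-plane. -/
noncomputable def thetaCont (r : ℕ) (s : ℂ) (x : ℝ) (K : ℕ) (z : ℂ) : ℂ :=
  (thetaPolar r s x (K + (r + 1)) z + thetaRem r s x (K + (r + 1)) z) / Complex.Gamma z

theorem meromorphicOn_thetaCont (r K : ℕ) {s : ℂ} {x : ℝ} (hx : 0 < x) {A : ℕ}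
    (hA : 1 < s.re + A) :
    MeromorphicOn (thetaCont r s x K) {z : ℂ | (A : ℝ) - K < z.re} := by
  intro z hz
  have hz' : (A : ℝ) - K < z.re := hz
  refine ((meromorphic_thetaPolar r s hx _ z).add
    (analyticAt_thetaRem r K hx hA ?_).meromorphicAt).div (Meromorphic.Gamma z)
  push_cast
  linarith [(Nat.cast_nonneg r : (0 : ℝ) ≤ r)]

theorem hasSum_thetaTerm_thetaCont (r K : ℕ) {s t : ℂ} {x : ℝ} (hx : 0 < x) {A : ℕ}
    (hA : 1 < s.re + A) (ht : A + 1 < t.re) :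
    HasSum (thetaTerm (r + 1 : ℕ) s t x) (thetaCont r s x K t) := by
  have hA0 : (0 : ℝ) ≤ A := Nat.cast_nonneg A
  have hr0 : (0 : ℝ) ≤ r := Nat.cast_nonneg r
  rw [thetaCont, ← mellin_eq_thetaPolar_add_thetaRem r hx _ hA ht]
  refine hasSum_thetaTerm_mellin hx (by linarith) ?_
  simp only [thetaRegion, Complex.add_re, Complex.natCast_re]
  push_cast
  exact ⟨by linarith, by linarith, by linarith⟩

theorem thetaRegion_of_re_gt (r : ℕ) {s t : ℂ} {A : ℕ} (hA : 1 < s.re + A) (ht : A + 1 < t.re) :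
    thetaRegion (r + 1 : ℕ) s t := by
  have hA0 : (0 : ℝ) ≤ A := Nat.cast_nonneg A
  have hr0 : (0 : ℝ) ≤ r := Nat.cast_nonneg r
  simp only [thetaRegion, Complex.add_re, Complex.natCast_re]
  push_cast
  exact ⟨by linarith, by linarith, by linarith⟩

theorem IsTheta.eventuallyEq_thetaCont {r : ℕ} {s : ℂ} {x : ℝ} (hx : 0 < x) {F : ℂ → ℂ}
    (hF : IsTheta (r + 1 : ℕ) s x F) {A : ℕ} (hA : 1 < s.re + A) {K : ℕ} {z : ℂ}
    (hz : (A : ℝ) - K < z.re) : F =ᶠ[𝓝[≠] z] thetaCont r s x K := by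
  refine eventuallyEq_nhdsNE_of_eqOn_halfPlane (c := A + 1) (hF.1.meromorphicOn)
    (meromorphicOn_thetaCont r K hx hA) (fun t ht => ?_) hz
  exact (hF.2 t (thetaRegion_of_re_gt r hA ht)).unique (hasSum_thetaTerm_thetaCont r K hx hA ht)

/-- The glued continuation is known to equal the series only for `Re t > A + 1`, whereas the region
of convergence is a possibly larger half-plane `Re t > σ`. The series is analytic there and `F` is
in normal form, so the identity theorem gives equality at every point and not just off a discrete
set. -/
theorem exists_isTheta (r : ℕ) (s : ℂ) {x : ℝ} (hx : 0 < x) :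
    ∃ F : ℂ → ℂ, IsTheta (r + 1 : ℕ) s x F := by
  obtain ⟨A, hA⟩ := exists_nat_one_lt_add s.re
  obtain ⟨F, hF, hFG⟩ := exists_meromorphic_of_halfPlanes (G := thetaCont r s x) (a := A) (c := A + 1)
    (fun n => meromorphicOn_thetaCont r n hx hA) (fun n m z hz =>
      (hasSum_thetaTerm_thetaCont r n hx hA hz).unique (hasSum_thetaTerm_thetaCont r m hx hA hz))
  have hFm : Meromorphic F := fun z => (hF z).meromorphicAt
  refine ⟨F, hFm, fun t ht => ?_⟩
  set σ : ℝ := max (max (1 - ((r + 1 : ℕ) : ℂ).re) (1 - s.re)) (2 - ((r + 1 : ℕ) : ℂ).re - s.re)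
    with hσ
  have hreg : ∀ w : ℂ, σ < w.re ↔ thetaRegion (r + 1 : ℕ) s w := by
    intro w
    rw [hσ, max_lt_iff, max_lt_iff, thetaRegion, and_assoc]
    simp only [Complex.add_re]
    refine and_congr ⟨fun h => by linarith, fun h => by linarith⟩
      (and_congr ⟨fun h => by linarith, fun h => by linarith⟩
        ⟨fun h => by linarith, fun h => by linarith⟩)
  have hT : ∀ w : ℂ, σ < w.re →
      AnalyticAt ℂ (fun w => ∑' p, thetaTerm (r + 1 : ℕ) s w x p) w := fun w hw =>
    DifferentiableOn.analyticAt (fun y hy => (differentiableAt_tsum_thetaTerm hx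
      ((hreg y).1 hy)).differentiableWithinAt) (re_gt_mem_nhds hw)
  set c : ℂ := ((max σ (A + 1) + 1 : ℝ) : ℂ) with hc
  have hcre : max σ (A + 1) < c.re := by simp [hc]
  have hc1 : (A : ℝ) + 1 < c.re := (le_max_right _ _).trans_lt hcre
  have hc2 : F =ᶠ[𝓝[≠] c] fun w => ∑' p, thetaTerm (r + 1 : ℕ) s w x p := by
    refine (hFG 0 c (by simp only [Nat.cast_zero]; linarith)).trans ?_
    refine Filter.Eventually.filter_mono nhdsWithin_le_nhds ?_
    filter_upwards [re_gt_mem_nhds hc1] with w hw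
    exact (hasSum_thetaTerm_thetaCont r 0 hx hA hw).tsum_eq.symm
  have htσ : σ < t.re := (hreg t).2 ht
  have key := hFm.meromorphicOn.eventuallyEq_nhdsNE_of_isPreconnected
    (fun w hw => (hT w hw).meromorphicAt) (isPreconnected_re_gt σ)
    ((le_max_left _ _).trans_lt hcre) htσ hc2
  rw [(hF t).eventuallyEq_nhdsNE_iff_eventuallyEq_nhds (hT t htσ).meromorphicNFAt] at key
  rw [key.eq_of_nhds]
  exact (summable_norm_thetaTerm hx ht).of_norm.hasSum

/-! ### Calculus of principal parts. -/

/-- `f` has at `z₀` a pole of order at most three with the principal part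
`a / (z - z₀) ^ 3 + b / (z - z₀) ^ 2 + c / (z - z₀)`. -/
def HasPrincipalPart (f : ℂ → ℂ) (z₀ a b c : ℂ) : Prop :=
  ∃ g : ℂ → ℂ, AnalyticAt ℂ g z₀ ∧
    f =ᶠ[𝓝[≠] z₀] fun z => a / (z - z₀) ^ 3 + b / (z - z₀) ^ 2 + c / (z - z₀) + g z

namespace HasPrincipalPart

variable {f f' : ℂ → ℂ} {z₀ a b c a' b' c' : ℂ}

theorem add (h : HasPrincipalPart f z₀ a b c) (h' : HasPrincipalPart f' z₀ a' b' c') :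
    HasPrincipalPart (fun z => f z + f' z) z₀ (a + a') (b + b') (c + c') := by
  obtain ⟨g, hg, hfg⟩ := h
  obtain ⟨g', hg', hfg'⟩ := h'
  refine ⟨fun z => g z + g' z, hg.add hg', ?_⟩
  filter_upwards [hfg, hfg'] with z h1 h2
  rw [h1, h2]
  ring

theorem const_mul (d : ℂ) (h : HasPrincipalPart f z₀ a b c) :
    HasPrincipalPart (fun z => d * f z) z₀ (d * a) (d * b) (d * c) := by
  obtain ⟨g, hg, hfg⟩ := h
  refine ⟨fun z => d * g z, analyticAt_const.mul hg, ?_⟩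
  filter_upwards [hfg] with z h1
  rw [h1]
  ring

theorem sub (h : HasPrincipalPart f z₀ a b c) (h' : HasPrincipalPart f' z₀ a' b' c') :
    HasPrincipalPart (fun z => f z - f' z) z₀ (a - a') (b - b') (c - c') := by
  have := h.add (h'.const_mul (-1))
  simpa [sub_eq_add_neg] using this

theorem congr (h : HasPrincipalPart f z₀ a b c) (hf : f =ᶠ[𝓝[≠] z₀] f') :
    HasPrincipalPart f' z₀ a b c := by
  obtain ⟨g, hg, hfg⟩ := h
  exact ⟨g, hg, hf.symm.trans hfg⟩

theorem of_analyticAt (h : AnalyticAt ℂ f z₀) : HasPrincipalPart f z₀ 0 0 0 :=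
  ⟨f, h, Eventually.of_forall fun z => by simp⟩

theorem sum {ι : Type*} (S : Finset ι) {f : ι → ℂ → ℂ} {a b c : ι → ℂ}
    (h : ∀ i ∈ S, HasPrincipalPart (f i) z₀ (a i) (b i) (c i)) :
    HasPrincipalPart (fun z => ∑ i ∈ S, f i z) z₀ (∑ i ∈ S, a i) (∑ i ∈ S, b i) (∑ i ∈ S, c i) := by
  classical
  induction S using Finset.induction_on with
  | empty => simpa using of_analyticAt (f := fun _ => 0) analyticAt_const
  | insert i S hi ih =>
    simp only [Finset.sum_insert hi]
    exact (h i (Finset.mem_insert_self i S)).add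
      (ih fun j hj => h j (Finset.mem_insert_of_mem hj))

theorem comp_add {w : ℂ} (h : HasPrincipalPart f (z₀ + w) a b c) :
    HasPrincipalPart (fun z => f (z + w)) z₀ a b c := by
  obtain ⟨g, hg, hfg⟩ := h
  refine ⟨fun z => g (z + w), hg.comp_of_eq (by fun_prop) rfl, ?_⟩
  have ht : Tendsto (fun z => z + w) (𝓝[≠] z₀) (𝓝[≠] (z₀ + w)) := by
    refine tendsto_nhdsWithin_iff.2 ⟨?_, ?_⟩
    · exact ((continuous_id.add continuous_const).tendsto z₀).mono_left nhdsWithin_le_nhds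
    · filter_upwards [self_mem_nhdsWithin] with z hz
      simpa using hz
  filter_upwards [ht.eventually hfg] with z hz
  rw [hz]
  simp

/-- A derivative has no residue. A pole of order at most two is assumed so that the derivative stays
within order three. -/
theorem deriv (h : HasPrincipalPart f z₀ 0 b c) :
    HasPrincipalPart (deriv f) z₀ (-2 * b) (-c) 0 := by
  obtain ⟨g, hg, hfg⟩ := h
  refine ⟨_root_.deriv g, hg.deriv, ?_⟩
  have hga := hg.eventually_analyticAt.filter_mono (nhdsWithin_le_nhds (s := {z₀}ᶜ))
  filter_upwards [hfg.nhdsNE_deriv, hga, self_mem_nhdsWithin] with z h1 h2 h3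
  have hz : z - z₀ ≠ 0 := sub_ne_zero.2 h3
  rw [h1]
  have hid : HasDerivAt (fun z : ℂ => z - z₀) 1 z := (hasDerivAt_id z).sub_const z₀
  have e2 := ((hasDerivAt_const z b).div (hid.pow 2) (pow_ne_zero 2 hz))
  have e1 := ((hasDerivAt_const z c).div hid hz)
  have e := (e2.add e1).add h2.differentiableAt.hasDerivAt
  have e' : HasDerivAt (fun z => 0 / (z - z₀) ^ 3 + b / (z - z₀) ^ 2 + c / (z - z₀) + g z) _ z :=
    e.congr_of_eventuallyEq (Eventually.of_forall fun y => by simp)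
  rw [e'.deriv]
  simp only [Pi.pow_apply]
  field_simp
  ring

theorem of_simple_pole (h : AnalyticAt ℂ f z₀) :
    HasPrincipalPart (fun z => f z / (z - z₀)) z₀ 0 0 (f z₀) := by
  obtain ⟨p, hp⟩ := h
  refine ⟨dslope f z₀, ⟨_, hp.has_fpower_series_dslope_fslope⟩, ?_⟩
  filter_upwards [self_mem_nhdsWithin] with z hz
  have hz' : z - z₀ ≠ 0 := sub_ne_zero.2 hz
  rw [dslope_of_ne _ hz, slope_def_field]
  field_simp
  ring

/-- The simple-pole case applied to `dslope f z₀`, whose value at `z₀` is `f'(z₀)`. -/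
theorem of_double_pole (h : AnalyticAt ℂ f z₀) :
    HasPrincipalPart (fun z => f z / (z - z₀) ^ 2) z₀ 0 (f z₀) (_root_.deriv f z₀) := by
  obtain ⟨p, hp⟩ := h
  have h1 : AnalyticAt ℂ (dslope f z₀) z₀ := ⟨_, hp.has_fpower_series_dslope_fslope⟩
  obtain ⟨g, hg, hfg⟩ := of_simple_pole h1
  refine ⟨g, hg, ?_⟩
  filter_upwards [self_mem_nhdsWithin, hfg] with z hz h2
  have hz' : z - z₀ ≠ 0 := sub_ne_zero.2 hz
  rw [dslope_same] at h2
  rw [dslope_of_ne _ hz, slope_def_field] at h2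
  have h3 : f z / (z - z₀) ^ 2 =
      (f z - f z₀) / (z - z₀) / (z - z₀) + f z₀ / (z - z₀) ^ 2 := by
    field_simp
    ring
  rw [h3, h2]
  ring

end HasPrincipalPart

/-! ### Principal parts of `Γ(z) x^{-z} ζ(s + z)` and of the polar part of the transform. -/

theorem analyticAt_Gamma_of_re_pos {z : ℂ} (hz : 0 < z.re) : AnalyticAt ℂ Complex.Gamma z := by
  refine DifferentiableOn.analyticAt (s := {z : ℂ | 0 < z.re}) (fun w hw => ?_) (re_gt_mem_nhds hz)
  refine (Complex.differentiableAt_Gamma w fun m hm => ?_).differentiableWithinAt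
  have hw' : 0 < w.re := hw
  rw [hm] at hw'
  simp only [Complex.neg_re, Complex.natCast_re] at hw'
  linarith [(Nat.cast_nonneg m : (0 : ℝ) ≤ m)]

/-- The behaviour of the Gamma function at its poles. -/
theorem exists_analyticAt_Gamma_neg_nat (j : ℕ) : ∃ φ : ℂ → ℂ, AnalyticAt ℂ φ (-j) ∧
    φ (-j) = (-1) ^ j / j.factorial ∧
    deriv φ (-j) = (-1) ^ j / j.factorial * ((harmonic j : ℂ) - Real.eulerMascheroniConstant) ∧
    ∀ᶠ z in 𝓝[≠] (-j : ℂ), Complex.Gamma z = φ z / (z - (-j)) := by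
  induction j with
  | zero =>
    refine ⟨fun z => Complex.Gamma (z + 1), ?_, by simp, ?_, ?_⟩
    · exact (analyticAt_Gamma_of_re_pos (z := 1) (by simp)).comp_of_eq (by fun_prop) (by simp)
    · have h := Complex.hasDerivAt_Gamma_one
      rw [show (1 : ℂ) = -((0 : ℕ) : ℂ) + 1 by simp] at h
      rw [(h.comp_add_const _ _).deriv]
      simp
    · filter_upwards [self_mem_nhdsWithin] with z hz
      have hz' : z ≠ 0 := by simpa using hz
      rw [Complex.Gamma_add_one z hz']
      field_simp
      simp [hz']
  | succ j ih =>
    obtain ⟨φ, h1, h2, h3, h4⟩ := ih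
    have hz0 : -((j + 1 : ℕ) : ℂ) + 1 = -j := by push_cast; ring
    have hne : -((j + 1 : ℕ) : ℂ) ≠ 0 := neg_ne_zero.2 (Nat.cast_ne_zero.2 j.succ_ne_zero)
    have hj : ((j : ℂ) + 1) ≠ 0 := Nat.cast_add_one_ne_zero j
    have hjf : ((j.factorial : ℕ) : ℂ) ≠ 0 := by exact_mod_cast j.factorial_ne_zero
    rw [← hz0] at h1
    have hφ : AnalyticAt ℂ (fun z => φ (z + 1)) (-((j + 1 : ℕ) : ℂ)) :=
      h1.comp_of_eq (by fun_prop) rfl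
    -- From `Γ(z) = Γ(z + 1)/z`. The logarithmic derivative of `1/z` at `-(j+1)` adds `1/(j+1)`,
    -- which builds up the harmonic number.
    refine ⟨fun z => φ (z + 1) / z, hφ.div analyticAt_id hne, ?_, ?_, ?_⟩
    · beta_reduce
      rw [hz0, h2, Nat.factorial_succ]
      push_cast
      field_simp
      ring
    · have hd : HasDerivAt (fun z => φ (z + 1)) (deriv φ (-j)) (-((j + 1 : ℕ) : ℂ)) := by
        refine HasDerivAt.comp_add_const _ _ ?_
        rw [← hz0]
        exact h1.differentiableAt.hasDerivAt
      have hd2 := (hd.div (hasDerivAt_id _) hne).deriv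
      refine Eq.trans hd2 ?_
      simp only [id]
      rw [hz0, h2, h3, Nat.factorial_succ, harmonic_succ]
      push_cast
      field_simp
      ring
    · have ht : Tendsto (fun z : ℂ => z + 1) (𝓝[≠] (-((j + 1 : ℕ) : ℂ))) (𝓝[≠] (-j : ℂ)) := by
        rw [← hz0]
        refine tendsto_nhdsWithin_iff.2 ⟨?_, ?_⟩
        · exact ((continuous_id.add continuous_const).tendsto _).mono_left nhdsWithin_le_nhds
        · filter_upwards [self_mem_nhdsWithin] with z hz
          have hz' : z ≠ -((j + 1 : ℕ) : ℂ) := hz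
          exact fun h => hz' (add_right_cancel (h : z + 1 = -((j + 1 : ℕ) : ℂ) + 1))
      have hev : ∀ᶠ z in 𝓝[≠] (-((j + 1 : ℕ) : ℂ)), z ≠ 0 :=
        nhdsWithin_le_nhds (isOpen_ne.mem_nhds hne)
      filter_upwards [ht.eventually h4, hev] with z hz hz1
      rw [Complex.Gamma_add_one z hz1] at hz
      have : z - -((j + 1 : ℕ) : ℂ) = z + 1 - -j := by push_cast; ring
      rw [this, div_right_comm, ← hz]
      field_simp

theorem ofReal_cpow_neg_neg_natCast {x : ℝ} (j : ℕ) : (x : ℂ) ^ (-(-(j : ℂ))) = (x : ℂ) ^ j := by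
  rw [neg_neg, Complex.cpow_natCast]

theorem analyticAt_riemannZeta_add {s z : ℂ} (h : s + z ≠ 1) :
    AnalyticAt ℂ (fun z => riemannZeta (s + z)) z :=
  (analyticAt_riemannZeta h).comp_of_eq (by fun_prop) rfl

theorem hasPrincipalPart_gammaZeta_neg_nat {s : ℂ} {x : ℝ} (hx : 0 < x) {j : ℕ}
    (hs : s ≠ j + 1) :
    HasPrincipalPart (gammaZeta s x) (-j) 0 0
      ((-1) ^ j / j.factorial * (x : ℂ) ^ j * riemannZeta (s - j)) := by
  obtain ⟨φ, h1, h2, _, h4⟩ := exists_analyticAt_Gamma_neg_nat j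
  have hz : s + -(j : ℂ) ≠ 1 := fun h => hs (by linear_combination h)
  have h := HasPrincipalPart.of_simple_pole ((h1.mul (analyticAt_ofReal_cpow_neg hx (-(j : ℂ)))).mul
    (analyticAt_riemannZeta_add hz))
  simp only [Pi.mul_apply] at h
  rw [h2, ofReal_cpow_neg_neg_natCast, ← sub_eq_add_neg] at h
  refine h.congr ?_
  filter_upwards [h4] with z hz
  rw [gammaZeta, hz]
  ring

/-- The poles of `Γ` and `ζ` coincide. In the residue, the `-γ` from `Γ` cancels the `+γ` from `ζ`,
leaving `H_j - log x`. -/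
theorem hasPrincipalPart_gammaZeta_neg_nat_of_eq {s : ℂ} {x : ℝ} (hx : 0 < x) {j : ℕ}
    (hs : s = j + 1) :
    HasPrincipalPart (gammaZeta s x) (-j) 0 ((-1) ^ j / j.factorial * (x : ℂ) ^ j)
      ((-1) ^ j / j.factorial * (x : ℂ) ^ j * ((harmonic j : ℂ) - (Real.log x : ℂ))) := by
  obtain ⟨φ, h1, h2, h3, h4⟩ := exists_analyticAt_Gamma_neg_nat j
  obtain ⟨g, g1, g2, g3⟩ := exists_analyticAt_riemannZeta_one
  have hsj : s + -(j : ℂ) = 1 := by rw [hs]; ring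
  have hx' : (x : ℂ) ≠ 0 := by exact_mod_cast hx.ne'
  have hga : AnalyticAt ℂ (fun z => g (s + z)) (-j : ℂ) := by
    rw [← hsj] at g1
    exact g1.comp_of_eq (by fun_prop) rfl
  have hpow := analyticAt_ofReal_cpow_neg hx (-(j : ℂ))
  have hlin : AnalyticAt ℂ (fun z : ℂ => z - -(j : ℂ)) (-j : ℂ) := by fun_prop
  have h := HasPrincipalPart.of_double_pole ((h1.mul hpow).mul
    ((analyticAt_const (v := (1 : ℂ))).add (hlin.mul hga)))
  have d1 := h1.differentiableAt.hasDerivAt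
  have d2 : HasDerivAt (fun z : ℂ => (x : ℂ) ^ (-z)) _ (-j : ℂ) :=
    (hasDerivAt_neg (-(j : ℂ))).const_cpow (Or.inl hx')
  have d3 := (hasDerivAt_const (-j : ℂ) (1 : ℂ)).add
    (((hasDerivAt_id (-j : ℂ)).sub_const (-(j : ℂ))).mul hga.differentiableAt.hasDerivAt)
  have d := ((d1.mul d2).mul d3).deriv
  have hd := Eq.trans (show deriv _ (-j : ℂ) = _ from d) rfl
  have e1 : deriv ((φ * fun z : ℂ => (x : ℂ) ^ (-z)) * ((fun _ => (1 : ℂ)) +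
      ((fun z => z - -(j : ℂ)) * fun z => g (s + z)))) (-j : ℂ) =
      (-1) ^ j / j.factorial * (x : ℂ) ^ j * ((harmonic j : ℂ) - (Real.log x : ℂ)) := by
    refine Eq.trans hd ?_
    simp only [Pi.mul_apply, Pi.add_apply, id, sub_self, zero_mul, add_zero, mul_one, one_mul,
      zero_add]
    rw [h2, h3, hsj, g2, ofReal_cpow_neg_neg_natCast, Complex.ofReal_log hx.le]
    ring
  rw [e1] at h
  simp only [Pi.mul_apply, Pi.add_apply, sub_self, zero_mul, add_zero, mul_one] at h
  rw [h2, ofReal_cpow_neg_neg_natCast] at h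
  refine h.congr ?_
  filter_upwards [h4, self_mem_nhdsWithin] with z hz hz0
  have hz1 : z - -(j : ℂ) ≠ 0 := sub_ne_zero.2 hz0
  have hz2 : s + z ≠ 1 := fun h => hz1 (by linear_combination h - hsj)
  have hz3 : s + z - 1 = z - -(j : ℂ) := by linear_combination hsj
  rw [gammaZeta, hz, g3 _ hz2, hz3]
  field_simp

theorem hasPrincipalPart_gammaZeta_of_re_pos {s z : ℂ} {x : ℝ} (hx : 0 < x) (hz : 0 < z.re)
    (hs : s + z ≠ 1) : HasPrincipalPart (gammaZeta s x) z 0 0 0 :=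
  HasPrincipalPart.of_analyticAt (((analyticAt_Gamma_of_re_pos hz).mul
    (analyticAt_ofReal_cpow_neg hx z)).mul (analyticAt_riemannZeta_add hs))

/-- Here `Γ` is regular and the pole is that of `ζ` alone; this is the source of the extra term for
integers `s ≤ 0`. -/
theorem hasPrincipalPart_gammaZeta_of_re_pos_of_eq {s z : ℂ} {x : ℝ} (hx : 0 < x) (hz : 0 < z.re)
    (hs : s + z = 1) :
    HasPrincipalPart (gammaZeta s x) z 0 0 (Complex.Gamma z * (x : ℂ) ^ (-z)) := by
  obtain ⟨g, g1, _, g3⟩ := exists_analyticAt_riemannZeta_one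
  have hga : AnalyticAt ℂ (fun z => g (s + z)) z := by
    rw [← hs] at g1
    exact g1.comp_of_eq (by fun_prop) rfl
  have hlin : AnalyticAt ℂ (fun w : ℂ => w - z) z := by fun_prop
  have h := HasPrincipalPart.of_simple_pole (((analyticAt_Gamma_of_re_pos hz).mul
    (analyticAt_ofReal_cpow_neg hx z)).mul ((analyticAt_const (v := (1 : ℂ))).add (hlin.mul hga)))
  simp only [Pi.mul_apply, Pi.add_apply, sub_self, zero_mul, add_zero, mul_one] at h
  refine h.congr ?_
  filter_upwards [self_mem_nhdsWithin] with w hw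
  have hw1 : w - z ≠ 0 := sub_ne_zero.2 hw
  have hw2 : s + w ≠ 1 := fun h => hw1 (by linear_combination h - hs)
  have hw3 : s + w - 1 = w - z := by linear_combination hs
  rw [gammaZeta, g3 _ hw2, hw3]
  field_simp

/-- Only the derivative in the logarithmic term raises the pole order, so the triple pole depends on
`b r` alone. -/
theorem hasPrincipalPart_thetaPolar {r : ℕ} {s z : ℂ} {x : ℝ} {K : ℕ} {b c : ℕ → ℂ}
    (h : ∀ k : ℕ, HasPrincipalPart (gammaZeta s x) (z + k) 0 (b k) (c k)) :
    HasPrincipalPart (thetaPolar r s x K) z ((-1) ^ r / r.factorial * (2 * b r))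
      (∑ k ∈ Finset.range K, polylogCoeff (r + 1) k * b k +
        (-1) ^ r / r.factorial * ((harmonic r : ℂ) * b r + c r))
      (∑ k ∈ Finset.range K, polylogCoeff (r + 1) k * c k +
        (-1) ^ r / r.factorial * ((harmonic r : ℂ) * c r)) := by
  have h1 := HasPrincipalPart.sum (Finset.range K) fun k _ =>
    ((h k).comp_add).const_mul (polylogCoeff (r + 1) k)
  have h2 := ((((h r).comp_add).const_mul (harmonic r : ℂ)).sub ((h r).deriv.comp_add)).const_mul
    ((-1) ^ r / (r.factorial : ℂ))
  convert! h1.add h2 using 1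
  · simp
  · ring
  · simp

/-! ### Third-order expansion of `1/Γ` at nonpositive integers. -/

theorem AnalyticAt.isBigO_sub_taylor {f : ℂ → ℂ} {z₀ : ℂ} (h : AnalyticAt ℂ f z₀) (n : ℕ) :
    (fun y => f (z₀ + y) - ∑ k ∈ Finset.range n, iteratedDeriv k f z₀ / k.factorial * y ^ k)
      =O[𝓝 0] fun y => y ^ n := by
  refine ((h.hasFPowerSeriesAt.isBigO_sub_partialSum_pow n).congr_left fun y => ?_).trans
    (IsBigO.of_bound 1 (Eventually.of_forall fun y => by simp))
  simp only [FormalMultilinearSeries.partialSum, FormalMultilinearSeries.ofScalars_apply_eq,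
    smul_eq_mul]

theorem sin_pi_mul_isBigO :
    (fun y : ℂ => Complex.sin (Real.pi * y) / Real.pi - (y - (Real.pi : ℂ) ^ 2 / 6 * y ^ 3))
      =O[𝓝 0] fun y => y ^ 4 := by
  have hπ : (Real.pi : ℂ) ≠ 0 := by exact_mod_cast Real.pi_ne_zero
  have h := (Complex.analyticAt_sin (x := 0)).isBigO_sub_taylor 4
  have ht : Tendsto (fun y : ℂ => (Real.pi : ℂ) * y) (𝓝 0) (𝓝 0) := by
    have hc : Continuous fun y : ℂ => (Real.pi : ℂ) * y := by fun_prop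
    simpa using hc.tendsto 0
  have h1 := ((h.comp_tendsto ht).const_mul_left (Real.pi : ℂ)⁻¹).trans
    (k := fun y : ℂ => y ^ 4) (IsBigO.of_bound (‖(Real.pi : ℂ)‖ ^ 4)
      (Eventually.of_forall fun y => by simp [mul_pow]))
  refine h1.congr_left fun y => ?_
  simp [Function.comp, Finset.sum_range_succ, iteratedDeriv_succ, iteratedDeriv_zero,
    Nat.factorial]
  field_simp
  ring

/-- The second Taylor coefficient of the Gamma function at a positive integer. -/
theorem iteratedDeriv_two_Gamma_nat (N : ℕ) :
    iteratedDeriv 2 Complex.Gamma ((N : ℂ) + 1) = N.factorial *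
      (deriv Complex.digamma ((N : ℂ) + 1) +
        ((harmonic N : ℂ) - Real.eulerMascheroniConstant) ^ 2) := by
  have hre : 0 < ((N : ℂ) + 1).re := by
    simp only [Complex.add_re, Complex.natCast_re, Complex.one_re]
    positivity
  have ha := analyticAt_Gamma_of_re_pos hre
  have hG : Complex.Gamma ((N : ℂ) + 1) = N.factorial := Complex.Gamma_nat_eq_factorial N
  have hne : ((N.factorial : ℕ) : ℂ) ≠ 0 := by exact_mod_cast N.factorial_ne_zero
  have hd := (Complex.hasDerivAt_Gamma_nat N).deriv
  have hdig : deriv Complex.digamma ((N : ℂ) + 1) = _ :=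
    (ha.deriv.differentiableAt.hasDerivAt.div ha.differentiableAt.hasDerivAt
      (by rw [hG]; exact hne)).deriv
  rw [hdig, hG, hd, iteratedDeriv_succ, iteratedDeriv_one]
  field_simp
  ring

theorem Gamma_nat_add_one_sub_isBigO (N : ℕ) :
    (fun y : ℂ => Complex.Gamma ((N : ℂ) + 1 - y) - N.factorial *
      (1 + (Real.eulerMascheroniConstant - (harmonic N : ℂ)) * y +
        (deriv Complex.digamma ((N : ℂ) + 1) +
          ((harmonic N : ℂ) - Real.eulerMascheroniConstant) ^ 2) / 2 * y ^ 2))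
      =O[𝓝 0] fun y => y ^ 3 := by
  have hre : 0 < ((N : ℂ) + 1).re := by
    simp only [Complex.add_re, Complex.natCast_re, Complex.one_re]
    positivity
  have h := (analyticAt_Gamma_of_re_pos hre).isBigO_sub_taylor 3
  have ht : Tendsto (fun y : ℂ => -y) (𝓝 0) (𝓝 0) := by
    simpa using (continuous_neg (G := ℂ)).tendsto 0
  have h1 := (h.comp_tendsto ht).trans (k := fun y : ℂ => y ^ 3)
    (IsBigO.of_bound 1 (Eventually.of_forall fun y => by simp))
  refine h1.congr_left fun y => ?_
  simp only [Function.comp, Finset.sum_range_succ, Finset.sum_range_zero, iteratedDeriv_zero,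
    iteratedDeriv_one, iteratedDeriv_two_Gamma_nat, (Complex.hasDerivAt_Gamma_nat N).deriv,
    Complex.Gamma_nat_eq_factorial, Nat.factorial]
  push_cast
  ring_nf

theorem inv_Gamma_eq_sin {z : ℂ} (hz : Complex.sin (Real.pi * z) ≠ 0) :
    (Complex.Gamma z)⁻¹ = Complex.Gamma (1 - z) * (Complex.sin (Real.pi * z) / Real.pi) := by
  have hπ : (Real.pi : ℂ) ≠ 0 := by exact_mod_cast Real.pi_ne_zero
  have h := Complex.Gamma_mul_Gamma_one_sub z
  have hne : Complex.Gamma z ≠ 0 := by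
    intro h0
    rw [h0, zero_mul] at h
    exact div_ne_zero hπ hz h.symm
  rw [inv_eq_iff_eq_inv, eq_comm, inv_eq_iff_eq_inv, ← mul_right_inj' hne, mul_inv_cancel₀ hne,
    ← mul_assoc, h]
  field_simp

/-- The expansion to third order of `1 / Γ` at a nonpositive integer. -/
theorem inv_Gamma_isBigO (N : ℕ) :
    (fun y : ℂ => (Complex.Gamma (-N + y))⁻¹ - (-1) ^ N * N.factorial *
      (y + (Real.eulerMascheroniConstant - (harmonic N : ℂ)) * y ^ 2 +
        ((deriv Complex.digamma ((N : ℂ) + 1) +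
          ((harmonic N : ℂ) - Real.eulerMascheroniConstant) ^ 2) / 2 - (Real.pi : ℂ) ^ 2 / 6) *
            y ^ 3)) =O[𝓝[≠] 0] fun y => y ^ 4 := by
  set g₁ : ℂ := Real.eulerMascheroniConstant - (harmonic N : ℂ)
  set g₂ : ℂ := (deriv Complex.digamma ((N : ℂ) + 1) +
    ((harmonic N : ℂ) - Real.eulerMascheroniConstant) ^ 2) / 2
  have hπ : (Real.pi : ℂ) ≠ 0 := by exact_mod_cast Real.pi_ne_zero
  have hA := Gamma_nat_add_one_sub_isBigO N
  have hB := sin_pi_mul_isBigO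
  have hbd : ∀ f : ℂ → ℂ, Continuous f → f =O[𝓝 0] fun _ => (1 : ℂ) := fun f hf =>
    (hf.tendsto 0).isBigO_one ℂ
  have hB1 : (fun y : ℂ => Complex.sin (Real.pi * y) / Real.pi) =O[𝓝 0] fun y => y := by
    have e1 : (fun y : ℂ => y ^ 4) =O[𝓝 0] fun y => y := by
      have := (hbd (fun y => y ^ 3) (by fun_prop)).mul (isBigO_refl (fun y : ℂ => y) (𝓝 0))
      simpa [← pow_succ] using this
    have e2 : (fun y : ℂ => y - (Real.pi : ℂ) ^ 2 / 6 * y ^ 3) =O[𝓝 0] fun y => y := by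
      have := (hbd (fun y => 1 - (Real.pi : ℂ) ^ 2 / 6 * y ^ 2) (by fun_prop)).mul
        (isBigO_refl (fun y : ℂ => y) (𝓝 0))
      simp only [one_mul] at this
      exact this.congr_left fun y => by ring
    exact ((hB.trans e1).add e2).congr_left fun y => by ring
  have h1 := hA.mul hB1
  have h2 := (hbd (fun y => N.factorial * (1 + g₁ * y + g₂ * y ^ 2)) (by fun_prop)).mul hB
  -- The terms of degree four and five in the product of the two truncated expansions.
  have h3 := (hbd (fun y => N.factorial * (-((Real.pi : ℂ) ^ 2 / 6) * g₁ -
    (Real.pi : ℂ) ^ 2 / 6 * g₂ * y)) (by fun_prop)).mul (isBigO_refl (fun y : ℂ => y ^ 4) (𝓝 0))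
  simp only [one_mul, ← pow_succ] at h1 h2 h3
  have h4 := (((h1.add h2).add h3).const_mul_left ((-1) ^ N)).mono
    (nhdsWithin_le_nhds (s := {(0 : ℂ)}ᶜ))
  refine h4.congr' ?_ (Eventually.of_forall fun _ => rfl)
  -- Within the punctured unit disc `sin(πy)` has no zero, so the reflection formula can be solved
  -- for `1/Γ`.
  have hball : ∀ᶠ y : ℂ in 𝓝[≠] 0, ‖y‖ < 1 :=
    by
    filter_upwards [nhdsWithin_le_nhds (Metric.ball_mem_nhds (0 : ℂ) one_pos)] with y hy
    simpa using hy
  filter_upwards [hball, self_mem_nhdsWithin] with y hy hy0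
  have hsin : Complex.sin (Real.pi * (-N + y)) = (-1) ^ N * Complex.sin (Real.pi * y) := by
    rw [show (Real.pi : ℂ) * (-N + y) = Real.pi * y - N * Real.pi by ring,
      Complex.sin_antiperiodic.sub_nat_mul_eq]
  have hne : Complex.sin (Real.pi * y) ≠ 0 := by
    rw [Complex.sin_ne_zero_iff]
    intro k hk
    rw [mul_comm] at hk
    have hk' := mul_right_cancel₀ hπ hk
    rw [hk', Complex.norm_intCast] at hy
    have hk0 : k = 0 := by
      rw [← Int.cast_abs, ← Int.cast_one, Int.cast_lt] at hy
      exact Int.abs_lt_one_iff.1 hy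
    exact hy0 (by simp [hk', hk0])
  rw [inv_Gamma_eq_sin (by rw [hsin]; exact mul_ne_zero (by simp) hne), hsin,
    show 1 - (-(N : ℂ) + y) = N + 1 - y by ring]
  ring

/-- The behaviour of `M / Γ` at a nonpositive integer at which `M` has a pole of order at most
three. -/
theorem HasPrincipalPart.div_Gamma_isBigO {F M : ℂ → ℂ} {N : ℕ} {a b c T₂ T₁ T₀ : ℂ}
    (hM : HasPrincipalPart M (-N) a b c) (hF : F =ᶠ[𝓝[≠] (-N : ℂ)] fun z => M z / Complex.Gamma z)
    (h₂ : T₂ = (-1) ^ N * N.factorial * a)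
    (h₁ : T₁ = (-1) ^ N * N.factorial * b +
      (-1) ^ N * N.factorial * a * (Real.eulerMascheroniConstant - (harmonic N : ℂ)))
    (h₀ : T₀ = (-1) ^ N * N.factorial * c +
      (-1) ^ N * N.factorial * b * (Real.eulerMascheroniConstant - (harmonic N : ℂ)) +
      (-1) ^ N * N.factorial * a * ((_root_.deriv Complex.digamma ((N : ℂ) + 1) +
          ((harmonic N : ℂ) - Real.eulerMascheroniConstant) ^ 2) / 2 - (Real.pi : ℂ) ^ 2 / 6)) :
    (fun z => F z - (T₂ / (z - (-N)) ^ 2 + T₁ / (z - (-N)) + T₀)) =O[𝓝[≠] (-N : ℂ)]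
      fun z => z - (-N) := by
  obtain ⟨g, hg, hMg⟩ := hM
  set g₁ : ℂ := Real.eulerMascheroniConstant - (harmonic N : ℂ)
  set g₂ : ℂ := (_root_.deriv Complex.digamma ((N : ℂ) + 1) +
    ((harmonic N : ℂ) - Real.eulerMascheroniConstant) ^ 2) / 2 - (Real.pi : ℂ) ^ 2 / 6
  set w : ℂ := (-1) ^ N * N.factorial
  have ht0 : Tendsto (fun z : ℂ => z - (-N)) (𝓝 (-N)) (𝓝 0) := by
    have hc : Continuous fun z : ℂ => z - (-N) := by fun_prop
    simpa using hc.tendsto (-(N : ℂ))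
  have ht : Tendsto (fun z : ℂ => z - (-N)) (𝓝[≠] (-N)) (𝓝[≠] 0) := by
    refine tendsto_nhdsWithin_iff.2 ⟨ht0.mono_left nhdsWithin_le_nhds, ?_⟩
    filter_upwards [self_mem_nhdsWithin] with z hz using sub_ne_zero.2 hz
  have hΓ := (inv_Gamma_isBigO N).comp_tendsto ht
  have hbd : ∀ f : ℂ → ℂ, ContinuousAt f (-N) → f =O[𝓝[≠] (-N : ℂ)] fun _ => (1 : ℂ) := fun f hf =>
    (hf.tendsto.mono_left nhdsWithin_le_nhds).isBigO_one ℂ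
  have hgc := hg.continuousAt
  -- This is `M` times `(z + N)^3`, which is bounded. The error `O((z + N)^4)` of `1/Γ` therefore
  -- contributes `O(z + N)`, and `e3` collects the remaining terms of positive degree.
  have e1 := hbd (fun z => a + b * (z - (-N)) + c * (z - (-N)) ^ 2 + g z * (z - (-N)) ^ 3)
    (by fun_prop)
  have e2 := (hΓ.mul e1).mul (isBigO_refl (fun z : ℂ => ((z - (-N)) ^ 3)⁻¹) (𝓝[≠] (-N : ℂ)))
  have e3 := (hbd (fun z => w * (g₁ * c + g₂ * b + g₂ * c * (z - (-N)) +
    (1 + g₁ * (z - (-N)) + g₂ * (z - (-N)) ^ 2) * g z)) (by fun_prop)).mul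
    (isBigO_refl (fun z : ℂ => z - (-N)) (𝓝[≠] (-N : ℂ)))
  simp only [one_mul, mul_one] at e2 e3
  have e4 := e2.trans (k := fun z : ℂ => z - (-N)) (IsBigO.of_bound 1 (by
    filter_upwards [self_mem_nhdsWithin] with z hz
    have hz' : z - (-N) ≠ 0 := sub_ne_zero.2 hz
    refine le_of_eq ?_
    rw [one_mul]
    congr 1
    simp only [Function.comp]
    field_simp))
  refine (e4.add e3).congr' ?_ (Eventually.of_forall fun _ => rfl)
  filter_upwards [hF, hMg, self_mem_nhdsWithin] with z hz1 hz2 hz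
  have hz' : z - (-N) ≠ 0 := sub_ne_zero.2 hz
  simp only [Function.comp]
  rw [hz1, hz2, h₂, h₁, h₀, show -(N : ℂ) + (z - (-N)) = z by ring, div_eq_mul_inv _ (Complex.Gamma z)]
  generalize (Complex.Gamma z)⁻¹ = G
  generalize z - (-(N : ℂ)) = y at *
  field_simp
  ring

/-! ### Assembling the coefficients in the four cases. -/

/-- The coefficient of `(z - (k - N)) ^ (-2)` in the Laurent expansion of `gammaZeta s x` at
`k - N`. -/
noncomputable def gammaZetaCoeffTwo (N : ℕ) (s : ℂ) (x : ℝ) (k : ℕ) : ℂ :=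
  open Classical in
  if k ≤ N ∧ s = (N - k : ℕ) + 1 then (-1) ^ (N - k) / (N - k).factorial * (x : ℂ) ^ (N - k) else 0

/-- The coefficient of `(z - (k - N)) ^ (-1)` in the Laurent expansion of `gammaZeta s x` at
`k - N`. -/
noncomputable def gammaZetaCoeffOne (N : ℕ) (s : ℂ) (x : ℝ) (k : ℕ) : ℂ :=
  open Classical in
  if k ≤ N then
    if s = (N - k : ℕ) + 1 then
      (-1) ^ (N - k) / (N - k).factorial * (x : ℂ) ^ (N - k) *
        ((harmonic (N - k) : ℂ) - (Real.log x : ℂ))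
    else (-1) ^ (N - k) / (N - k).factorial * (x : ℂ) ^ (N - k) * riemannZeta (s - (N - k : ℕ))
  else if s + (k - N : ℕ) = 1 then
    Complex.Gamma (k - N : ℕ) * (x : ℂ) ^ (-((k - N : ℕ) : ℂ))
  else 0

theorem hasPrincipalPart_gammaZeta (N : ℕ) (s : ℂ) {x : ℝ} (hx : 0 < x) (k : ℕ) :
    HasPrincipalPart (gammaZeta s x) (-N + k) 0 (gammaZetaCoeffTwo N s x k)
      (gammaZetaCoeffOne N s x k) := by
  unfold gammaZetaCoeffTwo gammaZetaCoeffOne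
  by_cases hk : k ≤ N
  · have hz : -(N : ℂ) + k = -((N - k : ℕ) : ℂ) := by
      rw [Nat.cast_sub hk]
      ring
    rw [hz, if_pos hk]
    by_cases hs : s = (N - k : ℕ) + 1
    · rw [if_pos ⟨hk, hs⟩, if_pos hs]
      exact hasPrincipalPart_gammaZeta_neg_nat_of_eq hx hs
    · rw [if_neg (fun h => hs h.2), if_neg hs]
      exact hasPrincipalPart_gammaZeta_neg_nat hx hs
  · have hz : -(N : ℂ) + k = ((k - N : ℕ) : ℂ) := by
      rw [Nat.cast_sub (not_le.1 hk).le]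
      ring
    have hpos : 0 < (((k - N : ℕ) : ℂ)).re := by
      rw [Complex.natCast_re, Nat.cast_pos]
      omega
    rw [hz, if_neg hk, if_neg (fun h => hk h.1)]
    by_cases hs : s + (k - N : ℕ) = 1
    · rw [if_pos hs]
      exact hasPrincipalPart_gammaZeta_of_re_pos_of_eq hx hpos hs
    · rw [if_neg hs]
      exact hasPrincipalPart_gammaZeta_of_re_pos hx hpos hs

/-- The expansion of the continued function at `-N` in terms of the Laurent coefficients of
`gammaZeta`, with arbitrarily many terms. -/
theorem IsTheta.exists_isBigO {r : ℕ} {s : ℂ} {x : ℝ} (hx : 0 < x) {F : ℂ → ℂ}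
    (hF : IsTheta (r + 1 : ℕ) s x F) (N K₀ : ℕ) : ∃ K, K₀ ≤ K ∧ ∀ T₂ T₁ T₀ B₂ B₁ S₂ S₁ w : ℂ,
      B₂ = gammaZetaCoeffTwo N s x r → B₁ = gammaZetaCoeffOne N s x r →
      w = (-1) ^ N * N.factorial →
      S₂ = w * ∑ k ∈ Finset.range K, polylogCoeff (r + 1) k * gammaZetaCoeffTwo N s x k →
      S₁ = w * ∑ k ∈ Finset.range K, polylogCoeff (r + 1) k * gammaZetaCoeffOne N s x k →
      T₂ = 2 * (w * ((-1) ^ r / r.factorial * B₂)) →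
      T₁ = S₂ + w * ((-1) ^ r / r.factorial * B₁) + w * ((-1) ^ r / r.factorial * B₂) *
        (harmonic r + 2 * (Real.eulerMascheroniConstant - (harmonic N : ℂ))) →
      T₀ = S₁ + S₂ * (Real.eulerMascheroniConstant - (harmonic N : ℂ)) +
        w * ((-1) ^ r / r.factorial * B₁) *
          (harmonic r + Real.eulerMascheroniConstant - (harmonic N : ℂ)) +
        w * ((-1) ^ r / r.factorial * B₂) *
          (harmonic r * (Real.eulerMascheroniConstant - (harmonic N : ℂ)) +
            deriv Complex.digamma ((N : ℂ) + 1) +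
              ((harmonic N : ℂ) - Real.eulerMascheroniConstant) ^ 2 - (Real.pi : ℂ) ^ 2 / 3) →
      (fun z => F z - (T₂ / (z - (-N)) ^ 2 + T₁ / (z - (-N)) + T₀)) =O[𝓝[≠] (-N : ℂ)]
        fun z => z - (-N) := by
  obtain ⟨A, hA⟩ := exists_nat_one_lt_add s.re
  -- The summand `A + N + 1` puts `-N` inside the half-plane where the remainder is analytic.
  refine ⟨K₀ + A + N + 1 + (r + 1), by omega, ?_⟩
  rintro T₂ T₁ T₀ B₂ B₁ S₂ S₁ w hB₂ hB₁ hw hS₂ hS₁ hT₂ hT₁ hT₀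
  have hz : (A : ℝ) - (K₀ + A + N + 1 : ℕ) < (-(N : ℂ)).re := by
    rw [Complex.neg_re, Complex.natCast_re]
    push_cast
    linarith [(Nat.cast_nonneg K₀ : (0 : ℝ) ≤ K₀)]
  have hrem := analyticAt_thetaRem r (K₀ + A + N + 1) hx hA (z := -(N : ℂ)) (by
    push_cast at hz ⊢
    linarith [(Nat.cast_nonneg r : (0 : ℝ) ≤ r)])
  have hM := (hasPrincipalPart_thetaPolar (r := r) (K := K₀ + A + N + 1 + (r + 1))
    (hasPrincipalPart_gammaZeta N s hx)).add (HasPrincipalPart.of_analyticAt hrem)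
  refine hM.div_Gamma_isBigO (hF.eventuallyEq_thetaCont hx hA hz) ?_ ?_ ?_
  · rw [hT₂, hB₂, hw]
    ring
  · rw [hT₁, hS₂, hB₁, hB₂, hw]
    ring
  · rw [hT₀, hS₁, hS₂, hB₁, hB₂, hw]
    ring

/-- The source of the binomial coefficients: the slope of `1/Γ` at `-N`, times the Taylor factor
`(-1)^k/k!`, times the residue of `Γ` at `-(N-k)`. -/
theorem neg_one_pow_mul_factorial_mul {N k : ℕ} (hk : k ≤ N) :
    (-1 : ℂ) ^ N * N.factorial * ((-1) ^ k / k.factorial * ((-1) ^ (N - k) / (N - k).factorial)) =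
      N.choose k := by
  have h1 : ((k.factorial : ℕ) : ℂ) ≠ 0 := by exact_mod_cast k.factorial_ne_zero
  have h2 : (((N - k).factorial : ℕ) : ℂ) ≠ 0 := by exact_mod_cast (N - k).factorial_ne_zero
  have h3 : (N.choose k : ℂ) * k.factorial * (N - k).factorial = N.factorial := by
    exact_mod_cast Nat.choose_mul_factorial_mul_factorial hk
  have h4 : (-1 : ℂ) ^ N * ((-1) ^ k * (-1) ^ (N - k)) = 1 := by
    rw [← pow_add, Nat.add_sub_cancel' hk, ← mul_pow]
    simp
  field_simp
  rw [← h3]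
  linear_combination (N.choose k : ℂ) * k.factorial * (N - k).factorial * h4

/-- Reduces the arbitrarily long sum to the indices `k ≤ N` of the theorem plus a single index `k₁`,
where the pole of `ζ` is met. -/
theorem sum_range_eq_sum_filter_add {M : Type*} [AddCommMonoid M] {n K k₁ : ℕ} (hK : n ≤ K)
    (hk₁ : k₁ < K) (p : ℕ → Prop) [DecidablePred p] {f g : ℕ → M} {E : M}
    (h : ∀ k < K, g k = (if k < n ∧ p k then f k else 0) + if k = k₁ then E else 0) :
    ∑ k ∈ Finset.range K, g k = ∑ k ∈ (Finset.range n).filter p, f k + E := by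
  rw [Finset.sum_congr rfl fun k hk => h k (Finset.mem_range.1 hk), Finset.sum_add_distrib,
    Finset.sum_ite_eq', if_pos (Finset.mem_range.2 hk₁), ← Finset.sum_filter]
  congr 2
  ext k
  simp only [Finset.mem_filter, Finset.mem_range]
  exact ⟨fun h => h.2, fun h => ⟨h.1.trans_le hK, h⟩⟩

theorem polylogCoeff_mul_gammaZetaCoeffOne {r N k : ℕ} {s : ℂ} {x : ℝ} (hk : k ≤ N) (hkr : k ≠ r)
    (hs : s ≠ (N - k : ℕ) + 1) :
    (-1 : ℂ) ^ N * N.factorial * (polylogCoeff (r + 1) k * gammaZetaCoeffOne N s x k) =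
      N.choose k * (x : ℂ) ^ (N - k) * riemannZeta (r + 1 - k) *
        riemannZeta (s - (N - k : ℕ)) := by
  rw [polylogCoeff, if_neg (by omega), gammaZetaCoeffOne, if_pos hk, if_neg hs,
    ← neg_one_pow_mul_factorial_mul hk]
  push_cast
  ring

theorem choose_mul_gammaZetaCoeffOne {r ℓ : ℕ} {s : ℂ} {x : ℝ} (hs : s ≠ ℓ + 1) :
    (-1 : ℂ) ^ (r + ℓ) * (r + ℓ).factorial *
        ((-1) ^ r / r.factorial * gammaZetaCoeffOne (r + ℓ) s x r) =
      (r + ℓ).choose ℓ * (x : ℂ) ^ ℓ * riemannZeta (s - ℓ) := by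
  rw [gammaZetaCoeffOne, if_pos (Nat.le_add_right r ℓ), Nat.add_sub_cancel_left, if_neg hs,
    ← Nat.choose_symm_add, ← neg_one_pow_mul_factorial_mul (Nat.le_add_right r ℓ),
    Nat.add_sub_cancel_left]
  ring

theorem natCast_add_one_ne_of_lt {k r ℓ : ℕ} (hk : k < r + ℓ + 1) (hkr : k ≠ r) :
    ((ℓ : ℂ) + 1) ≠ ((r + ℓ - k : ℕ) : ℂ) + 1 := by
  intro h
  have h1 := add_right_cancel h
  rw [Nat.cast_inj] at h1
  omega

theorem one_add_sub_eq {r ℓ k : ℕ} (s : ℂ) (hk : k < r + ℓ + 1) :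
    s - ((r + ℓ - k : ℕ) : ℂ) = 1 + k - ℓ - (r + 1 : ℕ) + s := by
  rw [Nat.cast_sub (by omega)]
  push_cast
  ring

/-- The expansion in the absence of coincidences between the poles of the Gamma function and of the
zeta function. The term `E` is the contribution of the pole of `ζ(s + z)` if it lies at a positive
integer. -/
theorem IsTheta.isBigO_of_forall_ne {r ℓ : ℕ} {s : ℂ} {x : ℝ} (hx : 0 < x) {F : ℂ → ℂ}
    (hF : IsTheta (r + 1 : ℕ) s x F) (hs : ∀ j : ℕ, j ≤ r + ℓ → s ≠ j + 1) (k₁ : ℕ) (E : ℂ)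
    (hE : ∀ k, r + ℓ < k → (-1) ^ (r + ℓ) * (r + ℓ).factorial *
      (polylogCoeff (r + 1) k * gammaZetaCoeffOne (r + ℓ) s x k) = if k = k₁ then E else 0)
    (hk₁ : r + ℓ < k₁) :
    (fun t : ℂ => F t -
      (((r + ℓ).choose ℓ : ℂ) * (x : ℂ) ^ ℓ * riemannZeta (s - ℓ) / (t - (-(r + ℓ : ℕ)))
      + ((r + ℓ).choose ℓ : ℂ) * (x : ℂ) ^ ℓ * riemannZeta (s - ℓ) *
          ((Real.eulerMascheroniConstant : ℂ) + (harmonic r : ℂ) - (harmonic (r + ℓ) : ℂ))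
      + ∑ k ∈ (Finset.range (r + ℓ + 1)).filter (fun k => k ≠ r),
          ((r + ℓ).choose k : ℂ) * (x : ℂ) ^ (r + ℓ - k) *
            riemannZeta ((r + 1 : ℕ) - k) * riemannZeta (1 + k - ℓ - (r + 1 : ℕ) + s) + E))
      =O[𝓝[≠] (-(r + ℓ : ℕ) : ℂ)] (fun t : ℂ => t - (-(r + ℓ : ℕ))) := by
  obtain ⟨K, hK, key⟩ := hF.exists_isBigO hx (r + ℓ) (k₁ + 1)
  have hTwo : ∀ k, gammaZetaCoeffTwo (r + ℓ) s x k = 0 := fun k => by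
    rw [gammaZetaCoeffTwo, if_neg fun h => hs _ (Nat.sub_le _ _) h.2]
  have hP := choose_mul_gammaZetaCoeffOne (r := r) (x := x) (hs ℓ (Nat.le_add_left ℓ r))
  have hsum := sum_range_eq_sum_filter_add (n := r + ℓ + 1) (K := K) (k₁ := k₁) (E := E)
    (p := fun k => k ≠ r)
    (g := fun k => (-1) ^ (r + ℓ) * ((r + ℓ).factorial : ℂ) *
      (polylogCoeff (r + 1) k * gammaZetaCoeffOne (r + ℓ) s x k))
    (f := fun k => ((r + ℓ).choose k : ℂ) * (x : ℂ) ^ (r + ℓ - k) *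
      riemannZeta ((r + 1 : ℕ) - k) * riemannZeta (1 + k - ℓ - (r + 1 : ℕ) + s))
    (by omega) (by omega) fun k _ => by
      by_cases hkN : k < r + ℓ + 1
      · rw [if_neg (by omega : ¬k = k₁), add_zero]
        by_cases hkr : k = r
        · rw [if_neg fun h => h.2 hkr, polylogCoeff, if_pos (by omega), zero_mul, mul_zero]
        · rw [if_pos ⟨hkN, hkr⟩, polylogCoeff_mul_gammaZetaCoeffOne (by omega) hkr
            (hs _ (Nat.sub_le _ _)), one_add_sub_eq s hkN]
          push_cast
          ring
      · rw [if_neg fun h => hkN h.1, zero_add, hE k (by omega)]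
  rw [← Finset.mul_sum] at hsum
  refine (key _ _ _ _ _ _ _ _ rfl rfl rfl rfl rfl rfl rfl rfl).congr_left fun t => ?_
  rw [hsum, hP]
  simp only [hTwo, mul_zero, Finset.sum_const_zero]
  ring

theorem gammaZetaCoeffOne_of_lt {N k : ℕ} {s : ℂ} (x : ℝ) (hk : N < k)
    (hs : s + (k - N : ℕ) ≠ 1) : gammaZetaCoeffOne N s x k = 0 := by
  rw [gammaZetaCoeffOne, if_neg (not_le.2 hk), if_neg hs]

/-- The contribution of the pole of the zeta function for `s = -m`. -/
theorem mul_gammaZetaCoeffOne_neg_nat {r ℓ m : ℕ} {x : ℝ} (hx : 0 < x) :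
    (-1 : ℂ) ^ (r + ℓ) * (r + ℓ).factorial * (polylogCoeff (r + 1) (r + ℓ + (m + 1)) *
      gammaZetaCoeffOne (r + ℓ) (-m) x (r + ℓ + (m + 1))) =
    (-1 : ℂ) ^ (-(m : ℤ) - 1) * (((r + ℓ).factorial : ℂ) * (m.factorial : ℂ) /
      ((r + ℓ + (m + 1)).factorial : ℂ)) * (x : ℂ) ^ (-(m : ℤ) - 1) * riemannZeta (-m - ℓ) := by
  have hx' : (x : ℂ) ≠ 0 := by exact_mod_cast hx.ne'
  have h1 : -(m : ℤ) - 1 = -((m + 1 : ℕ) : ℤ) := by push_cast; ring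
  have hG : Complex.Gamma ((m + 1 : ℕ) : ℂ) = m.factorial := by
    rw [Nat.cast_add_one, Complex.Gamma_nat_eq_factorial]
  rw [polylogCoeff, if_neg (by omega), gammaZetaCoeffOne, if_neg (by omega),
    Nat.add_sub_cancel_left, if_pos (by push_cast; ring), h1, zpow_neg, zpow_natCast, zpow_neg,
    zpow_natCast, Complex.cpow_neg, Complex.cpow_natCast, hG,
    show ((r + 1 : ℕ) : ℂ) - ((r + ℓ + (m + 1) : ℕ) : ℂ) = -m - ℓ by push_cast; ring]
  have h2 : (((r + ℓ + (m + 1)).factorial : ℕ) : ℂ) ≠ 0 := by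
    exact_mod_cast (r + ℓ + (m + 1)).factorial_ne_zero
  have h3 : (-1 : ℂ) ^ (r + ℓ) * (-1) ^ (r + ℓ) = 1 := by
    rw [← mul_pow]
    simp
  have h4 : ((-1 : ℂ) ^ (m + 1))⁻¹ = (-1) ^ (m + 1) := by
    rw [← inv_pow]
    simp
  rw [h4, pow_add (-1 : ℂ) (r + ℓ) (m + 1)]
  field_simp
  linear_combination ((r + ℓ).factorial : ℂ) * riemannZeta (-m - ℓ) * m.factorial * h3

/-- The expansion for `s = j + 1`, `j ≠ ℓ`. -/
theorem IsTheta.isBigO_of_natCast {r ℓ j : ℕ} {s : ℂ} {x : ℝ} (hx : 0 < x) {F : ℂ → ℂ}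
    (hF : IsTheta (r + 1 : ℕ) s x F) (hs : s = j + 1) (hj : j ≤ r + ℓ) (hjℓ : j ≠ ℓ) :
    (fun t : ℂ => F t -
      (((r + ℓ).choose ℓ : ℂ) * (x : ℂ) ^ ℓ * riemannZeta (s - ℓ) / (t - (-(r + ℓ : ℕ)))
      + ((r + ℓ).choose ℓ : ℂ) * (x : ℂ) ^ ℓ * riemannZeta (s - ℓ) *
          ((Real.eulerMascheroniConstant : ℂ) + (harmonic r : ℂ) - (harmonic (r + ℓ) : ℂ))
      + ((r + ℓ).choose j : ℂ) * (x : ℂ) ^ j * riemannZeta (s - ℓ) / (t - (-(r + ℓ : ℕ)))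
      + ((r + ℓ).choose j : ℂ) * (x : ℂ) ^ j * riemannZeta (s - ℓ) *
          ((Real.eulerMascheroniConstant : ℂ) + (harmonic j : ℂ) - (harmonic (r + ℓ) : ℂ)
            - (Real.log x : ℂ))
      + ∑ k ∈ (Finset.range (r + ℓ + 1)).filter (fun k => k ≠ r ∧ k ≠ r + ℓ - j),
          ((r + ℓ).choose k : ℂ) * (x : ℂ) ^ (r + ℓ - k) *
            riemannZeta ((r + 1 : ℕ) - k) * riemannZeta (1 + k - ℓ - (r + 1 : ℕ) + s)))
      =O[𝓝[≠] (-(r + ℓ : ℕ) : ℂ)] (fun t : ℂ => t - (-(r + ℓ : ℕ))) := by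
  obtain ⟨K, hK, key⟩ := hF.exists_isBigO hx (r + ℓ) (r + ℓ + 1)
  have hjk : r + ℓ - (r + ℓ - j) = j := by omega
  have hiff : ∀ k, k ≤ r + ℓ → (s = ((r + ℓ - k : ℕ) : ℂ) + 1 ↔ k = r + ℓ - j) := by
    intro k hk
    rw [hs, add_left_inj, Nat.cast_inj]
    omega
  have hsℓ : s ≠ ℓ + 1 := by
    rw [hs, Ne, add_left_inj, Nat.cast_inj]
    exact hjℓ
  have hTwo : ∀ k, k ≠ r + ℓ - j → gammaZetaCoeffTwo (r + ℓ) s x k = 0 := fun k hk => by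
    rw [gammaZetaCoeffTwo, if_neg fun h => hk ((hiff k h.1).1 h.2)]
  have hP := choose_mul_gammaZetaCoeffOne (r := r) (x := x) hsℓ
  have hchoose : (-1 : ℂ) ^ (r + ℓ) * (r + ℓ).factorial *
      ((-1) ^ (r + ℓ - j) / (r + ℓ - j).factorial * ((-1) ^ j / j.factorial)) =
      (r + ℓ).choose j := by
    rw [← Nat.choose_symm hj, ← neg_one_pow_mul_factorial_mul (Nat.sub_le _ _), hjk]
  -- At the coinciding index `k = r + ℓ - j` the coefficient is `ζ(j + 1 - ℓ) = ζ(s - ℓ)`, so both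
  -- polar terms carry the same zeta value.
  have hcoeff : polylogCoeff (r + 1) (r + ℓ - j) =
      riemannZeta (s - ℓ) * (-1) ^ (r + ℓ - j) / (r + ℓ - j).factorial := by
    rw [polylogCoeff, if_neg (by omega), hs, Nat.cast_sub hj]
    congr 3
    push_cast
    ring
  have htwo : (-1 : ℂ) ^ (r + ℓ) * (r + ℓ).factorial *
      (polylogCoeff (r + 1) (r + ℓ - j) * gammaZetaCoeffTwo (r + ℓ) s x (r + ℓ - j)) =
      (r + ℓ).choose j * (x : ℂ) ^ j * riemannZeta (s - ℓ) := by
    rw [hcoeff, gammaZetaCoeffTwo, if_pos ⟨Nat.sub_le _ _, (hiff _ (Nat.sub_le _ _)).2 rfl⟩, hjk,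
      ← hchoose]
    ring
  have hone : (-1 : ℂ) ^ (r + ℓ) * (r + ℓ).factorial *
      (polylogCoeff (r + 1) (r + ℓ - j) * gammaZetaCoeffOne (r + ℓ) s x (r + ℓ - j)) =
      (r + ℓ).choose j * (x : ℂ) ^ j * riemannZeta (s - ℓ) *
        ((harmonic j : ℂ) - (Real.log x : ℂ)) := by
    rw [hcoeff, gammaZetaCoeffOne, if_pos (Nat.sub_le _ _), if_pos ((hiff _ (Nat.sub_le _ _)).2 rfl),
      hjk, ← hchoose]
    ring
  have hsum := sum_range_eq_sum_filter_add (n := r + ℓ + 1) (K := K) (k₁ := r + ℓ - j)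
    (E := (r + ℓ).choose j * (x : ℂ) ^ j * riemannZeta (s - ℓ) *
        ((harmonic j : ℂ) - (Real.log x : ℂ)))
    (p := fun k => k ≠ r ∧ k ≠ r + ℓ - j)
    (g := fun k => (-1) ^ (r + ℓ) * ((r + ℓ).factorial : ℂ) *
      (polylogCoeff (r + 1) k * gammaZetaCoeffOne (r + ℓ) s x k))
    (f := fun k => ((r + ℓ).choose k : ℂ) * (x : ℂ) ^ (r + ℓ - k) *
      riemannZeta ((r + 1 : ℕ) - k) * riemannZeta (1 + k - ℓ - (r + 1 : ℕ) + s))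
    (by omega) (by omega) fun k _ => by
      by_cases hkj : k = r + ℓ - j
      · rw [if_pos hkj, if_neg fun h => h.2.2 hkj, zero_add, hkj, hone]
      rw [if_neg hkj, add_zero]
      by_cases hkN : k < r + ℓ + 1
      · by_cases hkr : k = r
        · rw [if_neg fun h => h.2.1 hkr, polylogCoeff, if_pos (by omega), zero_mul, mul_zero]
        · rw [if_pos ⟨hkN, hkr, hkj⟩, polylogCoeff_mul_gammaZetaCoeffOne (by omega) hkr
            (fun h => hkj ((hiff k (by omega)).1 h)), one_add_sub_eq s hkN]
          push_cast
          ring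
      · rw [if_neg fun h => hkN h.1, gammaZetaCoeffOne_of_lt x (by omega), mul_zero, mul_zero]
        rw [hs]
        norm_cast
        omega
  have hsum₂ : (-1 : ℂ) ^ (r + ℓ) * (r + ℓ).factorial *
      ∑ k ∈ Finset.range K, polylogCoeff (r + 1) k * gammaZetaCoeffTwo (r + ℓ) s x k =
      (r + ℓ).choose j * (x : ℂ) ^ j * riemannZeta (s - ℓ) := by
    rw [Finset.sum_eq_single (r + ℓ - j) (fun k _ hk => by rw [hTwo k hk, mul_zero])
      (fun h => absurd (Finset.mem_range.2 (by omega)) h), htwo]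
  rw [← Finset.mul_sum] at hsum
  refine (key _ _ _ _ _ _ _ _ rfl rfl rfl rfl rfl rfl rfl rfl).congr_left fun t => ?_
  rw [hsum, hP, hsum₂, hTwo r (by omega)]
  ring

/-- The expansion for `s = ℓ + 1`. -/
theorem IsTheta.isBigO_of_eq {r ℓ : ℕ} {s : ℂ} {x : ℝ} (hx : 0 < x) {F : ℂ → ℂ}
    (hF : IsTheta (r + 1 : ℕ) s x F) (hs : s = ℓ + 1) :
    (fun t : ℂ => F t -
      (((r + ℓ).choose ℓ : ℂ) * (2 * (x : ℂ) ^ ℓ) / (t - (-(r + ℓ : ℕ))) ^ 2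
      + ((r + ℓ).choose ℓ : ℂ) *
          ((x : ℂ) ^ ℓ * (2 * (Real.eulerMascheroniConstant : ℂ) + (harmonic ℓ : ℂ)
            + (harmonic r : ℂ) - 2 * (harmonic (r + ℓ) : ℂ)
            - (Real.log x : ℂ))) / (t - (-(r + ℓ : ℕ)))
      + 1 / 3 * ((r + ℓ).choose ℓ : ℂ) * (x : ℂ) ^ ℓ *
          (-(Real.pi : ℂ) ^ 2
            + 3 * ((Real.eulerMascheroniConstant : ℂ) + (harmonic ℓ : ℂ)
                - (harmonic (r + ℓ) : ℂ) - (Real.log x : ℂ))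
              * ((Real.eulerMascheroniConstant : ℂ) + (harmonic r : ℂ)
                - (harmonic (r + ℓ) : ℂ))
            + 3 * deriv Complex.digamma ((r + ℓ : ℕ) + 1 : ℂ))
      + ∑ k ∈ (Finset.range (r + ℓ + 1)).filter (fun k => k ≠ r),
          ((r + ℓ).choose k : ℂ) * (x : ℂ) ^ (r + ℓ - k) *
            riemannZeta ((r + 1 : ℕ) - k) * riemannZeta (k - (r + 1 : ℕ) + 2)))
      =O[𝓝[≠] (-(r + ℓ : ℕ) : ℂ)] (fun t : ℂ => t - (-(r + ℓ : ℕ))) := by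
  obtain ⟨K, hK, key⟩ := hF.exists_isBigO hx (r + ℓ) (r + ℓ + 1)
  have hne : ∀ k, k < r + ℓ + 1 → k ≠ r → s ≠ ((r + ℓ - k : ℕ) : ℂ) + 1 := fun k hk hkr => by
    rw [hs]
    exact natCast_add_one_ne_of_lt hk hkr
  -- The double pole sits at `k = r`, exactly where the Taylor coefficient vanishes; it is felt only
  -- through the logarithmic term.
  have hTwo : ∀ k, polylogCoeff (r + 1) k * gammaZetaCoeffTwo (r + ℓ) s x k = 0 := fun k => by
    by_cases hkr : k = r
    · rw [polylogCoeff, if_pos (by omega), zero_mul]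
    · rw [gammaZetaCoeffTwo, if_neg fun h => hne k (by omega) hkr h.2, mul_zero]
  have hchoose : (-1 : ℂ) ^ (r + ℓ) * (r + ℓ).factorial *
      ((-1) ^ r / r.factorial * ((-1) ^ ℓ / ℓ.factorial)) = (r + ℓ).choose ℓ := by
    rw [← Nat.choose_symm_add, ← neg_one_pow_mul_factorial_mul (Nat.le_add_right r ℓ),
      Nat.add_sub_cancel_left]
  have htwo : (-1 : ℂ) ^ (r + ℓ) * (r + ℓ).factorial *
      ((-1) ^ r / r.factorial * gammaZetaCoeffTwo (r + ℓ) s x r) =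
      (r + ℓ).choose ℓ * (x : ℂ) ^ ℓ := by
    rw [gammaZetaCoeffTwo, Nat.add_sub_cancel_left, if_pos ⟨Nat.le_add_right r ℓ, hs⟩, ← hchoose]
    ring
  have hone : (-1 : ℂ) ^ (r + ℓ) * (r + ℓ).factorial *
      ((-1) ^ r / r.factorial * gammaZetaCoeffOne (r + ℓ) s x r) =
      (r + ℓ).choose ℓ * (x : ℂ) ^ ℓ * ((harmonic ℓ : ℂ) - (Real.log x : ℂ)) := by
    rw [gammaZetaCoeffOne, if_pos (Nat.le_add_right r ℓ), Nat.add_sub_cancel_left, if_pos hs,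
      ← hchoose]
    ring
  have hsum := sum_range_eq_sum_filter_add (n := r + ℓ + 1) (K := K) (k₁ := 0) (E := 0)
    (p := fun k => k ≠ r)
    (g := fun k => (-1) ^ (r + ℓ) * ((r + ℓ).factorial : ℂ) *
      (polylogCoeff (r + 1) k * gammaZetaCoeffOne (r + ℓ) s x k))
    (f := fun k => ((r + ℓ).choose k : ℂ) * (x : ℂ) ^ (r + ℓ - k) *
      riemannZeta ((r + 1 : ℕ) - k) * riemannZeta (k - (r + 1 : ℕ) + 2))
    (by omega) (by omega) fun k _ => by
      rw [ite_self, add_zero]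
      by_cases hkN : k < r + ℓ + 1
      · by_cases hkr : k = r
        · rw [if_neg fun h => h.2 hkr, polylogCoeff, if_pos (by omega), zero_mul, mul_zero]
        · rw [if_pos ⟨hkN, hkr⟩, polylogCoeff_mul_gammaZetaCoeffOne (by omega) hkr
            (hne k hkN hkr), one_add_sub_eq s hkN,
            show (1 : ℂ) + k - ℓ - (r + 1 : ℕ) + s = k - (r + 1 : ℕ) + 2 by rw [hs]; ring]
          push_cast
          ring
      · rw [if_neg fun h => hkN h.1, gammaZetaCoeffOne_of_lt x (by omega), mul_zero, mul_zero]
        rw [hs]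
        norm_cast
        omega
  rw [← Finset.mul_sum, add_zero] at hsum
  -- In the constant term, `(γ - H_N)(H_r + γ - H_N)` and `(H_ℓ - log x)(H_r + γ - H_N)` combine
  -- into the product of the statement.
  refine (key _ _ _ _ _ _ _ _ rfl rfl rfl rfl rfl rfl rfl rfl).congr_left fun t => ?_
  rw [hsum, hone, htwo]
  simp only [hTwo, mul_zero, Finset.sum_const_zero]
  ring

theorem theorem2 (r ℓ : ℕ) (hr : 1 ≤ r) (s : ℂ) (x : ℝ) (hx : 0 < x) :
    (∃ F : ℂ → ℂ, IsTheta (r : ℂ) s x F) ∧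
    ∀ F : ℂ → ℂ, IsTheta (r : ℂ) s x F →
      -- Case 1
      (((∀ a : ℤ, s ≠ (a : ℂ)) ∨ (∃ a : ℤ, s = (a : ℂ) ∧ (r : ℤ) + ℓ < a)) →
        (fun t : ℂ => F t -
          (((r + ℓ - 1).choose ℓ : ℂ) * (x : ℂ) ^ ℓ * riemannZeta (s - ℓ) / (t - (1 - r - ℓ))
          + ((r + ℓ - 1).choose ℓ : ℂ) * (x : ℂ) ^ ℓ * riemannZeta (s - ℓ) *
              ((Real.eulerMascheroniConstant : ℂ) + (harmonic (r - 1) : ℂ)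
                - (harmonic (r + ℓ - 1) : ℂ))
          + ∑ k ∈ (Finset.range (r + ℓ)).filter (fun k => k ≠ r - 1),
              ((r + ℓ - 1).choose k : ℂ) * (x : ℂ) ^ (r + ℓ - 1 - k) *
                riemannZeta (r - k) * riemannZeta (1 + k - ℓ - r + s)))
          =O[𝓝[≠] ((1 : ℂ) - r - ℓ)] (fun t : ℂ => t - (1 - r - ℓ))) ∧
      -- Case 2
      (∀ a : ℤ, s = (a : ℂ) → a ≤ 0 → a ≤ (r : ℤ) + ℓ →
        (fun t : ℂ => F t -
          (((r + ℓ - 1).choose ℓ : ℂ) * (x : ℂ) ^ ℓ * riemannZeta (s - ℓ) / (t - (1 - r - ℓ))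
          + ((r + ℓ - 1).choose ℓ : ℂ) * (x : ℂ) ^ ℓ * riemannZeta (s - ℓ) *
              ((Real.eulerMascheroniConstant : ℂ) + (harmonic (r - 1) : ℂ)
                - (harmonic (r + ℓ - 1) : ℂ))
          + ∑ k ∈ (Finset.range (r + ℓ)).filter (fun k => k ≠ r - 1),
              ((r + ℓ - 1).choose k : ℂ) * (x : ℂ) ^ (r + ℓ - 1 - k) *
                riemannZeta (r - k) * riemannZeta (1 + k - ℓ - r + s)
          + (-1 : ℂ) ^ (a - 1) *
              (((r + ℓ - 1).factorial : ℂ) * ((-a).toNat.factorial : ℂ) /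
                (((r : ℤ) + ℓ - a).toNat.factorial : ℂ)) *
              (x : ℂ) ^ (a - 1) * riemannZeta (s - ℓ)))
          =O[𝓝[≠] ((1 : ℂ) - r - ℓ)] (fun t : ℂ => t - (1 - r - ℓ))) ∧
      -- Case 3
      (∀ a : ℕ, s = (a : ℂ) → 1 ≤ a → a ≤ r + ℓ → a ≠ ℓ + 1 →
        (fun t : ℂ => F t -
          (((r + ℓ - 1).choose ℓ : ℂ) * (x : ℂ) ^ ℓ * riemannZeta (s - ℓ) / (t - (1 - r - ℓ))
          + ((r + ℓ - 1).choose ℓ : ℂ) * (x : ℂ) ^ ℓ * riemannZeta (s - ℓ) *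
              ((Real.eulerMascheroniConstant : ℂ) + (harmonic (r - 1) : ℂ)
                - (harmonic (r + ℓ - 1) : ℂ))
          + ((r + ℓ - 1).choose (a - 1) : ℂ) * (x : ℂ) ^ (a - 1) * riemannZeta (s - ℓ) /
              (t - (1 - r - ℓ))
          + ((r + ℓ - 1).choose (a - 1) : ℂ) * (x : ℂ) ^ (a - 1) * riemannZeta (s - ℓ) *
              ((Real.eulerMascheroniConstant : ℂ) + (harmonic (a - 1) : ℂ)
                - (harmonic (r + ℓ - 1) : ℂ) - (Real.log x : ℂ))
          + ∑ k ∈ (Finset.range (r + ℓ)).filter (fun k => k ≠ r - 1 ∧ k ≠ r + ℓ - a),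
              ((r + ℓ - 1).choose k : ℂ) * (x : ℂ) ^ (r + ℓ - 1 - k) *
                riemannZeta (r - k) * riemannZeta (1 + k - ℓ - r + s)))
          =O[𝓝[≠] ((1 : ℂ) - r - ℓ)] (fun t : ℂ => t - (1 - r - ℓ))) ∧
      -- Case 4
      (s = (ℓ : ℂ) + 1 →
        (fun t : ℂ => F t -
          (((r + ℓ - 1).choose ℓ : ℂ) * (2 * (x : ℂ) ^ ℓ) / (t - (1 - r - ℓ)) ^ 2
          + ((r + ℓ - 1).choose ℓ : ℂ) *
              ((x : ℂ) ^ ℓ * (2 * (Real.eulerMascheroniConstant : ℂ) + (harmonic ℓ : ℂ)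
                + (harmonic (r - 1) : ℂ) - 2 * (harmonic (r + ℓ - 1) : ℂ)
                - (Real.log x : ℂ))) / (t - (1 - r - ℓ))
          + 1 / 3 * ((r + ℓ - 1).choose ℓ : ℂ) * (x : ℂ) ^ ℓ *
              (-(Real.pi : ℂ) ^ 2
                + 3 * ((Real.eulerMascheroniConstant : ℂ) + (harmonic ℓ : ℂ)
                    - (harmonic (r + ℓ - 1) : ℂ) - (Real.log x : ℂ))
                  * ((Real.eulerMascheroniConstant : ℂ) + (harmonic (r - 1) : ℂ)
                    - (harmonic (r + ℓ - 1) : ℂ))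
                + 3 * deriv Complex.digamma ((r : ℂ) + ℓ))
          + ∑ k ∈ (Finset.range (r + ℓ)).filter (fun k => k ≠ r - 1),
              ((r + ℓ - 1).choose k : ℂ) * (x : ℂ) ^ (r + ℓ - 1 - k) *
                riemannZeta (r - k) * riemannZeta (k - r + 2)))
          =O[𝓝[≠] ((1 : ℂ) - r - ℓ)] (fun t : ℂ => t - (1 - r - ℓ))) := by
  -- With `r` replaced by `r + 1`, the truncated subtractions disappear and `N = r + ℓ`.
  obtain ⟨r, rfl⟩ : ∃ q, r = q + 1 := ⟨r - 1, by omega⟩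
  have e₂ : r + 1 + ℓ = r + ℓ + 1 := by omega
  have e₃ : (1 : ℂ) - ((r + 1 : ℕ) : ℂ) - ℓ = -((r + ℓ : ℕ) : ℂ) := by
    push_cast
    ring
  have e₄ : ((r + 1 : ℕ) : ℂ) + ℓ = ((r + ℓ : ℕ) : ℂ) + 1 := by
    push_cast
    ring
  simp only [e₂, e₃, e₄, Nat.add_sub_cancel]
  refine ⟨exists_isTheta r s hx, fun F hF => ⟨fun h => ?_, ?_, ?_, fun h => ?_⟩⟩
  -- One condition excludes both a coincidence with a pole of `Γ` (`1 ≤ s ≤ N + 1`) and a pole of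
  -- `ζ` at a positive integer (`s ≤ 0`).
  · have hint : ∀ a : ℤ, a ≤ r + ℓ + 1 → s ≠ a := by
      rintro a ha rfl
      rcases h with h | ⟨b, hb, hlt⟩
      · exact h a rfl
      · rw [Int.cast_inj] at hb
        push_cast at hlt
        omega
    have hE : ∀ k, r + ℓ < k → (-1) ^ (r + ℓ) * ((r + ℓ).factorial : ℂ) *
        (polylogCoeff (r + 1) k * gammaZetaCoeffOne (r + ℓ) s x k) =
        if k = r + ℓ + 1 then 0 else 0 := by
      intro k hk
      rw [ite_self, gammaZetaCoeffOne_of_lt x hk, mul_zero, mul_zero]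
      intro h1
      refine hint (1 - (k - (r + ℓ) : ℕ)) (by omega) ?_
      push_cast
      linear_combination h1
    have h1 := hF.isBigO_of_forall_ne (ℓ := ℓ) hx (fun j hj hsj => hint (j + 1) (by omega)
      (by push_cast; exact hsj)) (r + ℓ + 1) 0 hE (by omega)
    simpa only [add_zero] using h1
  · rintro a rfl ha -
    obtain ⟨m, rfl⟩ : ∃ m : ℕ, a = -(m : ℤ) := ⟨(-a).toNat, by omega⟩
    have e₅ : (((r + 1 : ℕ) : ℤ) + ℓ - -(m : ℤ)).toNat = r + ℓ + (m + 1) := by omega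
    have e₆ : (-(-(m : ℤ))).toNat = m := by omega
    have e₇ : ((-(m : ℤ) : ℤ) : ℂ) = -(m : ℂ) := by push_cast; rfl
    simp only [e₅, e₆, e₇]
    rw [e₇] at hF
    rw [← mul_gammaZetaCoeffOne_neg_nat hx]
    -- For `s = -m` the pole `s + z + k = 1` at `z = -N` is met at `k = N + m + 1` only.
    refine hF.isBigO_of_forall_ne hx (fun j _ hj => ?_) (r + ℓ + (m + 1)) _ (fun k hk => ?_)
      (by omega)
    · have h0 : ((m + j + 1 : ℕ) : ℂ) = 0 := by
        push_cast
        linear_combination -hj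
      exact absurd h0 (Nat.cast_ne_zero.2 (by omega))
    · by_cases hkm : k = r + ℓ + (m + 1)
      · rw [if_pos hkm, hkm]
      · rw [if_neg hkm, gammaZetaCoeffOne_of_lt x hk, mul_zero, mul_zero]
        intro h1
        have h2 : (((k - (r + ℓ) : ℕ) : ℕ) : ℂ) = ((m + 1 : ℕ) : ℂ) := by
          push_cast at h1 ⊢
          linear_combination h1
        rw [Nat.cast_inj] at h2
        omega
  · intro a hs ha haN haℓ
    obtain ⟨j, rfl⟩ : ∃ j, a = j + 1 := ⟨a - 1, by omega⟩
    have e₅ : r + ℓ + 1 - (j + 1) = r + ℓ - j := by omega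
    simp only [e₅, Nat.add_sub_cancel]
    exact hF.isBigO_of_natCast hx (by rw [hs]; push_cast; rfl) (by omega) (by omega)
  · exact hF.isBigO_of_eq hx h
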